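/- \textbf{Theorem (Wick formula of type B).} Let $\alpha,q\in(-1,1)$, let $H_{\mathbb R}$ be a separable real Hilbert space with complexification $H$ (inner product linear on the right), and let $x\mapsto\bar x$ be a self-adjoint involution of $H$ (a linear map with $\bar{\bar x}=x$ and $\langle\bar x,y\rangle=\langle x,\bar y\rangle$). Let $\Sigma(n)$ be the group of bijections $\sigma$ of $\{\pm1,\dots,\pm n\}$ with $\sigma(-k)=-\sigma(k)$, generated by $\pi_0=(1,-1)$ and $\pi_i=(i,i+1)$, $1\le i\le n-1$, acting on $H^{\otimes n}$ by letting $\pi_0$ replace $x_1$ by $\overline{x_1}$ and $\pi_i$ exchange the factors $i$ and $i+1$; let $l_1(\sigma)$ (resp. $l_2(\sigma)$) be the number of $\pi_0$ (resp. of $\pi_i$ with $i\ge1$) in a minimal length expression of $\sigma$. On the algebraic Fock space $\mathcal F=\bigoplus_{n\ge0}H^{\otimes n}$, with $H^{\otimes0}=\mathbb C\Omega$, put $$\langle f,g\rangle_{\alpha,q}=\sum_{n}\Big\langle f_n,\sum_{\sigma\in\Sigma(n)}\alpha^{l_1(\sigma)}q^{l_2(\sigma)}\sigma\, g_n\Big\rangle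 ,\qquad \langle x_1\otimes\cdots\otimes x_n,y_1\otimes\cdots\otimes y_n\rangle=\prod_i\langle x_i,y_i\rangle ,$$ with $0^0=1$. Let $b^*(x)$ be the operator $x_1\otimes\cdots\otimes x_n\mapsto x_1\otimes\cdots\otimes x_n\otimes x$, $\Omega\mapsto x$. For every $x\in H$ it has exactly one adjoint on $\mathcal F$ with respect to $\langle\cdot,\cdot\rangle_{\alpha,q}$, denoted $b^1(x)=b(x)$. For $\epsilon\in\{1,*\}^n$ let $P_{1,2;\epsilon}(n)$ be the set of the partitions $\pi$ of $\{1,\dots,n\}$ into pairs and singletons such that $\epsilon(a)=*$, $\epsilon(b)=1$ for every pair $\{a<b\}$ of $\pi$ and $\epsilon(c)=*$ for every singleton $\{c\}$ of $\pi$; let $P^B_{1,2;\epsilon}(n)$ be the set of $(\pi,f)$ with $\pi\in P_{1,2;\epsilon}(n)$ and $f$ a colouring of the blocks of $\pi$ by $\pm1$ that is $1$ on singletons. Say that a block $W$ covers a block $V$ if there are $i,j\in W$ with $i<k<j$ for all $k\in V$, and that a singleton $\{i\}$ is to the left of $V$ if $i<j$ for all $j\in V$. Let $\mathrm{Cr}(\pi)$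 be the number of unordered pairs of blocks $\{V,W\}$ with $i<k<j<l$ for some $i,j\in V$, $k,l\in W$; $\mathrm{InS}(\pi)$ the number of $(V,W)$ with $V$ a singleton covered by $W$; $\mathrm{NB}(\pi,f)$ the number of blocks of colour $-1$; $\mathrm{InNB}(\pi,f)$ the number of $(V,W)$ with $V$ a pair of colour $-1$ covered by $W$; $\mathrm{SLNB}(\pi,f)$ the number of $(V,W)$ with $V$ a singleton to the left of a pair $W$ of colour $-1$; $\mathrm{Cov}(V)$ the number of blocks covering $V$; $\mathrm{SL}(V)$ the number of singletons to the left of $V$. For a pair we write $\{i,j\}$ with $i>j$. Then for all $n\ge0$, all $x_1,\dots,x_n\in H_{\mathbb R}$ and all $\epsilon\in\{1,*\}^n$, $$b^{\epsilon(n)}(x_n)\cdots b^{\epsilon(1)}(x_1)\Omega=\sum_{(\pi,f)\in P^B_{1,2;\epsilon}(n)}\alpha^{\mathrm{NB}(\pi,f)}q^{\mathrm{Cr}(\pi)+\mathrm{InS}(\pi)+2\mathrm{InNB}(\pi,f)+2\mathrm{SLNB}(\pi,f)}\prod_{f(\{i,j\})=1}\langle x_i,x_j\rangle\prod_{f(\{i,j\})=-1}\langle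 x_i,\overline{x_j}\rangle\ \bigotimes_{\{i\}\in\pi}x_i,$$ where the products are over the pairs of $\pi$ of the indicated colour, and the tensor product is over the singletons in increasing order (it is $\Omega$ if there are none). Moreover, $$b^{\epsilon(n)}(x_n)\cdots b^{\epsilon(1)}(x_1)\Omega=\sum_{\pi\in P_{1,2;\epsilon}(n)}q^{\mathrm{Cr}(\pi)+\mathrm{InS}(\pi)}\prod_{\{i,j\}\in\pi,\ i>j}\Big(\langle x_i,x_j\rangle+\alpha q^{2\mathrm{Cov}(\{i,j\})+2\mathrm{SL}(\{i,j\})}\langle x_i,\overline{x_j}\rangle\Big)\bigotimes_{\{i\}\in\pi}x_i .$$ Here $\langle x_i,x_j\rangle=\langle x_j,x_i\rangle$ always, and if the involution maps $H_{\mathbb R}$ into itself, then also $\langle x_i,\overline{x_j}\rangle=\langle x_j,\overline{x_i}\rangle$ for all $i,j$, so that the order of the two elements of a pair is immaterial. -/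

import Mathlib

open scoped TensorProduct DirectSum ComplexConjugate InnerProductSpace

noncomputable section

namespace TypeBFock

/-! ### The complexification of a real inner product space -/

/-- The complexification of a real vector space `V`: the pair `(a, b)` stands for `a + i b`. -/
def Complexification (V : Type*) : Type _ := V × V

namespace Complexification

variable {V : Type*} [NormedAddCommGroup V] [InnerProductSpace ℝ V]

instance instAddCommGroup : AddCommGroup (Complexification V) :=
  inferInstanceAs (AddCommGroup (V × V))

/-- The real part. -/
def re (z : Complexification V) : V := z.1

/-- The imaginary part. -/
def im (z : Complexification V) : V := z.2

/-- The element `a + i b`. -/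
def mk (a b : V) : Complexification V := (a, b)

/-- The canonical inclusion of the real space in its complexification. -/
def ofReal (a : V) : Complexification V := mk a 0

@[ext] theorem ext {z w : Complexification V} (h₁ : z.re = w.re) (h₂ : z.im = w.im) : z = w :=
  Prod.ext h₁ h₂

@[simp] theorem re_mk (a b : V) : (mk a b).re = a := rfl
@[simp] theorem im_mk (a b : V) : (mk a b).im = b := rfl
@[simp] theorem re_zero : (0 : Complexification V).re = 0 := rfl
@[simp] theorem im_zero : (0 : Complexification V).im = 0 := rfl
@[simp] theorem re_add (z w : Complexification V) : (z + w).re = z.re + w.re := rfl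
@[simp] theorem im_add (z w : Complexification V) : (z + w).im = z.im + w.im := rfl

/-- `(r + i s) • (a + i b) = (r a - s b) + i (r b + s a)`. -/
instance instSMul : SMul ℂ (Complexification V) where
  smul c z := mk (c.re • z.re - c.im • z.im) (c.re • z.im + c.im • z.re)

@[simp] theorem re_smul (c : ℂ) (z : Complexification V) :
    (c • z).re = c.re • z.re - c.im • z.im := rfl
@[simp] theorem im_smul (c : ℂ) (z : Complexification V) :
    (c • z).im = c.re • z.im + c.im • z.re := rfl

instance instModule : Module ℂ (Complexification V) where
  one_smul z := by ext <;> simp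
  mul_smul c d z := by
    ext
    · simp only [re_smul, im_smul, Complex.mul_re, Complex.mul_im]; module
    · simp only [re_smul, im_smul, Complex.mul_re, Complex.mul_im]; module
  smul_zero c := by ext <;> simp
  smul_add c z w := by
    ext
    · simp only [re_smul, re_add, im_add]; module
    · simp only [im_smul, re_add, im_add]; module
  add_smul c d z := by
    ext
    · simp only [re_smul, re_add, Complex.add_re, Complex.add_im]; module
    · simp only [im_smul, im_add, Complex.add_re, Complex.add_im]; module
  zero_smul z := by ext <;> simp

/-- The sesquilinear extension of the real inner product, linear on the right and antilinear on
the left. -/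
@[reducible] def innerCore : InnerProductSpace.Core ℂ (Complexification V) where
  inner z w := ⟨⟪z.re, w.re⟫_ℝ + ⟪z.im, w.im⟫_ℝ, ⟪z.re, w.im⟫_ℝ - ⟪z.im, w.re⟫_ℝ⟩
  conj_inner_symm z w := by
    apply Complex.ext
    · simp [real_inner_comm]
    · simp [real_inner_comm]
  re_inner_nonneg z := by
    have h₁ : 0 ≤ ⟪z.re, z.re⟫_ℝ := real_inner_self_nonneg
    have h₂ : 0 ≤ ⟪z.im, z.im⟫_ℝ := real_inner_self_nonneg
    exact add_nonneg h₁ h₂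
  add_left x y z := by
    apply Complex.ext
    · simp only [re_add, im_add, inner_add_left, Complex.add_re]; ring
    · simp only [re_add, im_add, inner_add_left, Complex.add_im]; ring
  smul_left x y r := by
    apply Complex.ext
    · simp only [re_smul, im_smul, inner_add_left, inner_sub_left, real_inner_smul_left,
        Complex.mul_re, Complex.conj_re, Complex.conj_im]
      ring
    · simp only [re_smul, im_smul, inner_add_left, inner_sub_left, real_inner_smul_left,
        Complex.mul_im, Complex.conj_re, Complex.conj_im]
      ring
  definite z hz := by
    have h : ⟪z.re, z.re⟫_ℝ + ⟪z.im, z.im⟫_ℝ = 0 := congrArg Complex.re hz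
    have h₁ : 0 ≤ ⟪z.re, z.re⟫_ℝ := real_inner_self_nonneg
    have h₂ : 0 ≤ ⟪z.im, z.im⟫_ℝ := real_inner_self_nonneg
    ext
    · exact inner_self_eq_zero.mp (by linarith : ⟪z.re, z.re⟫_ℝ = 0)
    · exact inner_self_eq_zero.mp (by linarith : ⟪z.im, z.im⟫_ℝ = 0)

instance instNormedAddCommGroup : NormedAddCommGroup (Complexification V) :=
  innerCore.toNormedAddCommGroup

instance instInnerProductSpace : InnerProductSpace ℂ (Complexification V) :=
  InnerProductSpace.ofCore innerCore.toCore

theorem inner_def (z w : Complexification V) :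
    ⟪z, w⟫_ℂ =
      ⟨⟪z.re, w.re⟫_ℝ + ⟪z.im, w.im⟫_ℝ, ⟪z.re, w.im⟫_ℝ - ⟪z.im, w.re⟫_ℝ⟩ := rfl

end Complexification

/-! ### The Coxeter group of type B -/

/-- The Coxeter group of type B: the bijections `σ` of `{±1, …, ±n}` with `σ (-k) = -σ k`.
The point `±(k + 1)` is encoded as the pair `(k, ±1)` with `k : Fin n`. -/
def hyperoctahedral (n : ℕ) : Subgroup (Equiv.Perm (Fin n × ℤˣ)) where
  carrier := {σ | ∀ k s, σ (k, -s) = ((σ (k, s)).1, -(σ (k, s)).2)}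
  mul_mem' {σ τ} hσ hτ k s := by
    change ∀ k s, _ at hσ hτ
    rw [Equiv.Perm.mul_apply, hτ, hσ, Equiv.Perm.mul_apply]
  one_mem' k s := rfl
  inv_mem' {σ} hσ k s := by
    change ∀ k s, _ at hσ
    rw [Equiv.Perm.inv_eq_iff_eq, hσ]
    simp

instance (n : ℕ) : Fintype (hyperoctahedral n) := Fintype.ofFinite _

/-- The Coxeter generators `π₀ = (1, -1)` and `π_i = (i, i + 1)`, `1 ≤ i ≤ n - 1`. -/
def generator (n : ℕ) (i : Fin n) : Equiv.Perm (Fin n × ℤˣ) :=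
  if i.val = 0 then Equiv.swap (i, 1) (i, -1)
  else Equiv.prodCongr
    (Equiv.swap ⟨i.val - 1, lt_of_le_of_lt (Nat.sub_le _ _) i.isLt⟩ i) (Equiv.refl ℤˣ)

/-- `w` is an irreducible (minimal length) expression of `σ` as a product of generators. -/
def IsReducedWord {n : ℕ} (w : List (Fin n)) (σ : hyperoctahedral n) : Prop :=
  (w.map (generator n)).prod = σ.1 ∧
    ∀ w' : List (Fin n), (w'.map (generator n)).prod = σ.1 → w.length ≤ w'.length

/-- The number of `π₀` appearing in an irreducible expression of `σ`
(all irreducible expressions have the same number). -/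
def length₁ {n : ℕ} (σ : hyperoctahedral n) : ℕ :=
  sInf {k | ∃ w, IsReducedWord w σ ∧ k = w.countP (fun i => i.val = 0)}

/-- The number of `π_i`, `1 ≤ i ≤ n - 1`, appearing in an irreducible expression of `σ`
(all irreducible expressions have the same number). -/
def length₂ {n : ℕ} (σ : hyperoctahedral n) : ℕ :=
  sInf {k | ∃ w, IsReducedWord w σ ∧ k = w.countP (fun i => i.val ≠ 0)}

/-- The permutation `k ↦ |σ k|` of the `n` positions. -/
def absPerm {n : ℕ} (σ : hyperoctahedral n) : Equiv.Perm (Fin n) where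
  toFun k := (σ.1 (k, 1)).1
  invFun k := (σ.1⁻¹ (k, 1)).1
  left_inv k := by
    change (σ.1⁻¹ ((σ.1 (k, 1)).1, 1)).1 = k
    rcases Int.units_eq_one_or (σ.1 (k, 1)).2 with hs | hs
    · have : ((σ.1 (k, 1)).1, (1 : ℤˣ)) = σ.1 (k, 1) := Prod.ext rfl hs.symm
      rw [this]; simp
    · have h1 : ((σ.1 (k, 1)).1, (1 : ℤˣ)) = σ.1 (k, -1) := by
        rw [σ.2 k 1, hs]; simp
      rw [h1]; simp
  right_inv k := by
    change (σ.1 ((σ.1⁻¹ (k, 1)).1, 1)).1 = k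
    rcases Int.units_eq_one_or (σ.1⁻¹ (k, 1)).2 with hs | hs
    · have : ((σ.1⁻¹ (k, 1)).1, (1 : ℤˣ)) = σ.1⁻¹ (k, 1) := Prod.ext rfl hs.symm
      rw [this]; simp
    · have h1 : ((σ.1⁻¹ (k, 1)).1, (1 : ℤˣ)) = σ.1⁻¹ (k, -1) := by
        have := (σ⁻¹).2 k 1
        rw [Subgroup.coe_inv] at this
        rw [this, hs]; simp
      rw [h1]; simp

/-! ### Tensor powers -/

section Tensor

variable {H : Type*} [NormedAddCommGroup H] [InnerProductSpace ℂ H]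

/-- The action of the Coxeter group of type B on `H^{⊗ n}` determined by an involution `J` of `H`:
the factor `x_k` moves to position `|σ k|` and becomes `J x_k` when `σ k` is negative. -/
def groupAction (J : H →ₗ[ℂ] H) {n : ℕ} (σ : hyperoctahedral n) :
    (⨂[ℂ]^n H) →ₗ[ℂ] (⨂[ℂ]^n H) :=
  (PiTensorProduct.reindex ℂ (fun _ : Fin n => H) (absPerm σ)).toLinearMap ∘ₗ
    PiTensorProduct.map (fun k : Fin n => if (σ.1 (k, 1)).2 = 1 then LinearMap.id else J)

theorem groupAction_tprod (J : H →ₗ[ℂ] H) {n : ℕ} (σ : hyperoctahedral n) (x : Fin n → H) :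
    groupAction J σ (PiTensorProduct.tprod ℂ x) = PiTensorProduct.tprod ℂ (fun j =>
      (if (σ.1 ((absPerm σ).symm j, 1)).2 = 1 then LinearMap.id else J : H →ₗ[ℂ] H)
        (x ((absPerm σ).symm j))) := by
  simp [groupAction]

/-- The type B symmetrization operator `P^{(n)}_{α,q} = ∑_σ α^{l₁(σ)} q^{l₂(σ)} σ`. -/
def symmetrizer (J : H →ₗ[ℂ] H) (α q : ℝ) (n : ℕ) : (⨂[ℂ]^n H) →ₗ[ℂ] (⨂[ℂ]^n H) :=
  ∑ σ : hyperoctahedral n, ((α : ℂ) ^ length₁ σ * (q : ℂ) ^ length₂ σ) • groupAction J σ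

/-- The linear form `x₁ ⊗ ⋯ ⊗ x_n ↦ ∏ ⟨y_i, x_i⟩`. -/
def prodForm {n : ℕ} (y : Fin n → H) : MultilinearMap ℂ (fun _ : Fin n => H) ℂ :=
  (MultilinearMap.mkPiAlgebra ℂ (Fin n) ℂ).compLinearMap (fun i => innerₛₗ ℂ (y i))

theorem prodForm_apply {n : ℕ} (y v : Fin n → H) : prodForm y v = ∏ i, ⟪y i, v i⟫_ℂ := by
  simp [prodForm]

theorem conj_prodForm {n : ℕ} (y v : Fin n → H) : conj (prodForm y v) = prodForm v y := by
  simp [prodForm_apply, map_prod]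

/-- The antilinear form `x₁ ⊗ ⋯ ⊗ x_n ↦ ∏ ⟨x_i, y_i⟩`, as a multilinear function of `y`. -/
def tensorInnerAux (n : ℕ) :
    MultilinearMap ℂ (fun _ : Fin n => H) ((⨂[ℂ]^n H) →ₗ⋆[ℂ] ℂ) where
  toFun y := (starLinearEquiv ℂ : ℂ ≃ₗ⋆[ℂ] ℂ).toLinearMap.comp (PiTensorProduct.lift (prodForm y))
  map_update_add' y i a b := by
    have h : prodForm (Function.update y i (a + b)) =
        prodForm (Function.update y i a) + prodForm (Function.update y i b) := by
      ext v
      apply (starRingEnd ℂ).injective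
      rw [add_apply, map_add]
      simp only [conj_prodForm]
      exact (prodForm v).map_update_add y i a b
    rw [h, map_add, LinearMap.comp_add]
  map_update_smul' y i c a := by
    have h : prodForm (Function.update y i (c • a)) =
        conj c • prodForm (Function.update y i a) := by
      ext v
      apply (starRingEnd ℂ).injective
      rw [smul_apply, smul_eq_mul, map_mul, Complex.conj_conj]
      simp only [conj_prodForm]
      exact (prodForm v).map_update_smul y i c a
    rw [h, map_smul]
    ext t
    simp

/-- The inner product `⟨x₁ ⊗ ⋯ ⊗ x_n, y₁ ⊗ ⋯ ⊗ y_n⟩₀₀ = ∏ ⟨x_i, y_i⟩` on `H^{⊗ n}`. -/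
def tensorInner (n : ℕ) : (⨂[ℂ]^n H) →ₗ⋆[ℂ] (⨂[ℂ]^n H) →ₗ[ℂ] ℂ :=
  (PiTensorProduct.lift (tensorInnerAux (H := H) n)).flip

theorem tensorInner_tprod (n : ℕ) (x y : Fin n → H) :
    tensorInner n (PiTensorProduct.tprod ℂ x) (PiTensorProduct.tprod ℂ y) =
      ∏ i, ⟪x i, y i⟫_ℂ := by
  simp [tensorInner, tensorInnerAux, prodForm_apply]

end Tensor

/-! ### The Fock space of type B -/

/-- The algebraic full Fock space `⨁ₙ H^{⊗ n}`. -/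
abbrev Fock (H : Type*) [NormedAddCommGroup H] [InnerProductSpace ℂ H] : Type _ :=
  ⨁ n : ℕ, ⨂[ℂ]^n H

section Fock

variable {H : Type*} [NormedAddCommGroup H] [InnerProductSpace ℂ H]

/-- The pure tensor `x₁ ⊗ ⋯ ⊗ x_n` in the Fock space. -/
def pureTensor {n : ℕ} (x : Fin n → H) : Fock H :=
  DirectSum.lof ℂ ℕ (fun n => ⨂[ℂ]^n H) n (PiTensorProduct.tprod ℂ x)

/-- The vacuum vector `Ω`. -/
def vacuum : Fock H := pureTensor (Fin.elim0 : Fin 0 → H)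

/-- The deformed inner product `⟨f, g⟩_{α,q} = ∑ₙ ⟨fₙ, P^{(n)}_{α,q} gₙ⟩₀₀`. -/
def fockInner (J : H →ₗ[ℂ] H) (α q : ℝ) (f g : Fock H) : ℂ :=
  DirectSum.toModule ℂ ℕ ℂ (fun n => tensorInner n (f n) ∘ₗ symmetrizer J α q n) g

/-- The linear map `x₁ ⊗ ⋯ ⊗ x_n ↦ x₁ ⊗ ⋯ ⊗ x_n ⊗ x` on `H^{⊗ n}`. -/
def appendTensor (x : H) (n : ℕ) : (⨂[ℂ]^n H) →ₗ[ℂ] (⨂[ℂ]^(n + 1) H) :=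
  PiTensorProduct.lift ((LinearMap.applyₗ x).compMultilinearMap
    (PiTensorProduct.tprod ℂ (s := fun _ : Fin (n + 1) => H)).curryRight)

/-- The (right) creation operator of type B. -/
def creation (x : H) : Module.End ℂ (Fock H) :=
  DirectSum.toModule ℂ ℕ (Fock H)
    (fun n => DirectSum.lof ℂ ℕ (fun n => ⨂[ℂ]^n H) (n + 1) ∘ₗ appendTensor x n)

theorem creation_pureTensor (x : H) {n : ℕ} (v : Fin n → H) :
    creation x (pureTensor v) = pureTensor (Fin.snoc v x : Fin (n + 1) → H) := by
  simp [creation, pureTensor, appendTensor]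

/-- `T` is an adjoint of the creation operator `b*(x)` for the deformed inner product. -/
def IsCreationAdjoint (J : H →ₗ[ℂ] H) (α q : ℝ) (x : H) (T : Module.End ℂ (Fock H)) : Prop :=
  ∀ f g : Fock H, fockInner J α q (creation x f) g = fockInner J α q f (T g)

open Classical in
/-- The annihilation operator of type B: the adjoint of `creation x` for the deformed inner
product. -/
def annihilation (J : H →ₗ[ℂ] H) (α q : ℝ) (x : H) : Module.End ℂ (Fock H) :=
  if h : ∃ T, IsCreationAdjoint J α q x T then h.choose else 0

/-- The alphabet `{1, ∗}`. -/
inductive Exponent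
  | one
  | star

/-- `b^∗(x)` is the creation operator and `b^1(x)` is the annihilation operator. -/
def fockOp (J : H →ₗ[ℂ] H) (α q : ℝ) : Exponent → H → Module.End ℂ (Fock H)
  | .one, x => annihilation J α q x
  | .star, x => creation x

/-- The operator `b^{ε(n)}(x_n) ⋯ b^{ε(1)}(x_1)`. -/
def fockWord (J : H →ₗ[ℂ] H) (α q : ℝ) {n : ℕ} (ε : Fin n → Exponent) (x : Fin n → H) :
    Module.End ℂ (Fock H) :=
  (List.ofFn fun i => fockOp J α q (ε i) (x i)).reverse.prod

/-- The tensor product `⨂_{i ∈ S} x_i`, in increasing order of the indices; it is `Ω` when `S` is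
empty. -/
def tensorOver {n : ℕ} (x : Fin n → H) (S : Finset (Fin n)) : Fock H :=
  pureTensor (fun k : Fin S.card => x (S.orderEmbOfFin rfl k))

end Fock

/-! ### Set partitions of type B and their statistics -/

/-- The set partitions of `{1, …, n}`. -/
abbrev SetPartition (n : ℕ) : Type := Finpartition (Finset.univ : Finset (Fin n))

/-- The blocks of a set partition. -/
abbrev Block {n : ℕ} (π : SetPartition n) : Type := {V : Finset (Fin n) // V ∈ π.parts}

/-- The set partitions of type B of `{1, …, n}`: a set partition with a `±1` colouring of its
blocks. -/
abbrev SetPartitionB (n : ℕ) : Type := (π : SetPartition n) × (Block π → ℤˣ)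

section Partition

variable {n : ℕ}

/-- The smallest element of a block. -/
def lo {π : SetPartition n} (V : Block π) : Fin n := V.1.min' (π.nonempty_of_mem_parts V.2)

/-- The largest element of a block. -/
def hi {π : SetPartition n} (V : Block π) : Fin n := V.1.max' (π.nonempty_of_mem_parts V.2)

/-- The block is a singleton. -/
def IsSingleton {π : SetPartition n} (V : Block π) : Prop := V.1.card = 1

/-- The block is a pair. -/
def IsPair {π : SetPartition n} (V : Block π) : Prop := V.1.card = 2

/-- All blocks are singletons or pairs; in a pair `{a < b}` one has `ε(a) = ∗` and `ε(b) = 1`, and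
`ε(c) = ∗` for every singleton `{c}`. -/
def IsCompatible (ε : Fin n → Exponent) (π : SetPartition n) : Prop :=
  ∀ V : Block π, (IsPair V ∧ ε (lo V) = .star ∧ ε (hi V) = .one) ∨
    (IsSingleton V ∧ ε (lo V) = .star)

open Classical in
/-- The set `P_{1,2;ε}(n)`. -/
def partitions (ε : Fin n → Exponent) : Finset (SetPartition n) :=
  {π | IsCompatible ε π}

open Classical in
/-- The set `P^B_{1,2;ε}(n)`: singletons have colour `1`. -/
def partitionsB (ε : Fin n → Exponent) : Finset (SetPartitionB n) :=
  {p | IsCompatible ε p.1 ∧ ∀ V : Block p.1, IsSingleton V → p.2 V = 1}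

open Classical in
/-- The pair blocks. -/
def pairs (π : SetPartition n) : Finset (Block π) := {V | IsPair V}

open Classical in
/-- The set of the `i` such that `{i}` is a singleton of the partition. -/
def singletons (π : SetPartition n) : Finset (Fin n) := {i | {i} ∈ π.parts}

/-- `W` covers `V`. -/
def Covers {π : SetPartition n} (W V : Block π) : Prop :=
  ∃ i ∈ W.1, ∃ j ∈ W.1, ∀ k ∈ V.1, i < k ∧ k < j

/-- `V` is to the left of `W`. -/
def LeftOf {π : SetPartition n} (V W : Block π) : Prop :=
  ∀ i ∈ V.1, ∀ j ∈ W.1, i < j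

open Classical in
/-- `Cr`: the number of unordered pairs `{V, W}` of blocks that cross. -/
def crossings (π : SetPartition n) : ℕ :=
  Finset.card {S : Finset (Block π) | ∃ V W : Block π, V ≠ W ∧ S = {V, W} ∧
    ∃ i ∈ V.1, ∃ j ∈ V.1, ∃ k ∈ W.1, ∃ l ∈ W.1, i < k ∧ k < j ∧ j < l}

open Classical in
/-- `InS`: the number of pairs of a singleton and a covering block. -/
def innerSingletons (π : SetPartition n) : ℕ :=
  Finset.card {P : Block π × Block π | IsSingleton P.1 ∧ Covers P.2 P.1}

open Classical in
/-- `NB`: the number of negative blocks. -/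
def negativeBlocks (p : SetPartitionB n) : ℕ :=
  Finset.card {V : Block p.1 | p.2 V = -1}

open Classical in
/-- `InNB`: the number of pairs of a negative pair block and a covering block. -/
def innerNegativeBlocks (p : SetPartitionB n) : ℕ :=
  Finset.card {P : Block p.1 × Block p.1 | IsPair P.1 ∧ p.2 P.1 = -1 ∧ Covers P.2 P.1}

open Classical in
/-- `SLNB`: the number of pairs of a negative pair block and a singleton to the left of it. -/
def singletonsLeftNegative (p : SetPartitionB n) : ℕ :=
  Finset.card {P : Block p.1 × Block p.1 |
    IsPair P.2 ∧ p.2 P.2 = -1 ∧ IsSingleton P.1 ∧ LeftOf P.1 P.2}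

open Classical in
/-- `Cov(V)`: the number of blocks that cover `V`. -/
def coverCount {π : SetPartition n} (V : Block π) : ℕ :=
  Finset.card {W : Block π | Covers W V}

open Classical in
/-- `SL(V)`: the number of singletons to the left of `V`. -/
def singletonsLeft {π : SetPartition n} (V : Block π) : ℕ :=
  Finset.card {W : Block π | IsSingleton W ∧ LeftOf W V}

end Partition

end TypeBFock

end

/-!
The reflection hyperplanes of type B that separate `σ` from `τ` are counted by the two lengths of
`σ τ⁻¹`, according to their kind. Hence the kernel `α ^ l₁(σ τ⁻¹) * q ^ l₂(σ τ⁻¹)` is a product over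
the hyperplanes of factors `1` or `c`, `c ∈ (-1, 1)`; expanding these in the characters of a cube
shows that it is positive definite. So the symmetrizers are invertible, the form
`⟨·,·⟩_{α,q}` is nondegenerate, and a creation operator has at most one adjoint. Decomposing the
signed permutations of `n + 1` letters by the position and the sign of the factor that they move to
the end exhibits an adjoint: it contracts the `k`-th of `n + 1` factors, `0 ≤ k ≤ n`, with
coefficient `q ^ (n - k) * (⟨x, x_k⟩ + α * q ^ (2 * k) * ⟨x, J x_k⟩)`.

The Wick formula then follows by induction on the length of the word. A creation operator adds a
singleton, and contracting the `k`-th of the `n + 1` open singletons closes it to a pair with the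
new point. The `n - k` open singletons to its right are covered by the new pair, and the `k` ones to
its left give the exponent `2 * SL`. Multiplying out the factors `⟨·,·⟩ + α * q ^ (⋯) * ⟨·, J ·⟩` of
the pairs gives the colourings.
-/

noncomputable section

namespace TypeBFock

/-! ### Signed permutations and their inversions -/

section SignedPerm

variable {n : ℕ}

/-- The sign of `σ k` for a positive `k`; with `absPerm σ` it determines `σ`. -/
def signAt (σ : hyperoctahedral n) (k : Fin n) : ℤˣ := (σ.1 (k, 1)).2

theorem hyperoctahedral_apply (σ : hyperoctahedral n) (k : Fin n) (t : ℤˣ) :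
    σ.1 (k, t) = (absPerm σ k, signAt σ k * t) := by
  rcases Int.units_eq_one_or t with rfl | rfl
  · rw [mul_one]; rfl
  · rw [σ.2 k 1]; simp [absPerm, signAt]

theorem hyperoctahedral_ext {σ τ : hyperoctahedral n} (h_abs : absPerm σ = absPerm τ)
    (h_sign : signAt σ = signAt τ) : σ = τ := by
  apply Subtype.ext
  ext1 ⟨k, t⟩
  rw [hyperoctahedral_apply, hyperoctahedral_apply, h_abs, h_sign]

@[simp] theorem absPerm_one : absPerm (1 : hyperoctahedral n) = 1 := rfl

@[simp] theorem signAt_one (k : Fin n) : signAt (1 : hyperoctahedral n) k = 1 := rfl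

theorem absPerm_mul (σ τ : hyperoctahedral n) : absPerm (σ * τ) = absPerm σ * absPerm τ := by
  ext1 k
  change (σ.1 (τ.1 (k, 1))).1 = _
  rw [hyperoctahedral_apply τ, hyperoctahedral_apply σ]; rfl

theorem signAt_mul (σ τ : hyperoctahedral n) (k : Fin n) :
    signAt (σ * τ) k = signAt σ (absPerm τ k) * signAt τ k := by
  change (σ.1 (τ.1 (k, 1))).2 = _
  rw [hyperoctahedral_apply τ, hyperoctahedral_apply σ, mul_one]

/-- The signed permutation `(k, t) ↦ (p k, s k * t)`. -/
def ofPermSign (p : Equiv.Perm (Fin n)) (s : Fin n → ℤˣ) : hyperoctahedral n :=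
  ⟨{ toFun := fun a => (p a.1, s a.1 * a.2)
     invFun := fun a => (p.symm a.1, s (p.symm a.1) * a.2)
     left_inv := fun a => by ext1 <;> simp [← mul_assoc, Int.units_mul_self]
     right_inv := fun a => by ext1 <;> simp [← mul_assoc, Int.units_mul_self] },
   fun k t => by simp⟩

@[simp] theorem absPerm_ofPermSign (p : Equiv.Perm (Fin n)) (s : Fin n → ℤˣ) :
    absPerm (ofPermSign p s) = p := by
  ext1 k; rfl

@[simp] theorem signAt_ofPermSign (p : Equiv.Perm (Fin n)) (s : Fin n → ℤˣ) :
    signAt (ofPermSign p s) = s := by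
  ext1 k; simp [signAt, ofPermSign]

/-- The decomposition of a signed permutation into its absolute values and its signs. -/
def signedPermEquiv (n : ℕ) : hyperoctahedral n ≃ Equiv.Perm (Fin n) × (Fin n → ℤˣ) where
  toFun σ := (absPerm σ, signAt σ)
  invFun a := ofPermSign a.1 a.2
  left_inv σ := hyperoctahedral_ext (by simp) (by simp)
  right_inv a := by simp

/-- The number of negative signs, which is the `π₀`-length of a signed permutation with
signs `s`. -/
def negCount (s : Fin n → ℤˣ) : ℕ := Finset.card {k | s k = -1}

/-- The contribution of a pair of positions to `pairInv`. -/
def pairTerm (p : Equiv.Perm (Fin n)) (s : Fin n → ℤˣ) (c : Fin n × Fin n) : ℕ :=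
  if c.1 < c.2 then (if p c.2 < p c.1 then 1 else if s c.2 = -1 then 2 else 0) else 0

/-- The number of positive roots `e_j ± e_i`, `i < j`, that the signed permutation with absolute
values `p` and signs `s` makes negative. If `p j < p i` then exactly one of the two roots becomes
negative; otherwise the sign of `s j` decides for both. -/
def pairInv (p : Equiv.Perm (Fin n)) (s : Fin n → ℤˣ) : ℕ := ∑ c, pairTerm p s c

/-- The number of all inversions of a signed permutation. -/
def inversions (σ : hyperoctahedral n) : ℕ :=
  negCount (signAt σ) + pairInv (absPerm σ) (signAt σ)

theorem negCount_one : negCount (1 : Fin n → ℤˣ) = 0 := by simp [negCount]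

theorem pairInv_one : pairInv (1 : Equiv.Perm (Fin n)) 1 = 0 := by
  refine Finset.sum_eq_zero fun c _ => ?_
  unfold pairTerm
  split_ifs with hlt hinv hneg
  · exact absurd hinv hlt.not_gt
  · exact absurd hneg (by rw [Pi.one_apply]; decide)
  all_goals rfl

theorem negCount_update_neg_one (s : Fin n → ℤˣ) (k : Fin n) :
    negCount (Function.update s k (-1)) = negCount (Function.update s k 1) + 1 := by
  have h_insert : ({j | Function.update s k (-1) j = -1} : Finset (Fin n)) =
      insert k ({j | Function.update s k 1 j = -1} : Finset (Fin n)) := by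
    ext j
    rcases eq_or_ne j k with rfl | hj <;> simp [*]
  rw [negCount, h_insert, Finset.card_insert_of_notMem (by simp), negCount]

theorem swap_lt_swap_iff_of_covBy {ι : Type*} [LinearOrder ι] {a b : ι} (hab : a ⋖ b) {i j : ι}
    (h_fwd : ¬(i = a ∧ j = b)) (h_bwd : ¬(i = b ∧ j = a)) :
    Equiv.swap a b i < Equiv.swap a b j ↔ i < j := by
  have h_ge : ∀ c, a < c ↔ b ≤ c := fun c => ⟨hab.ge_of_gt, hab.lt.trans_le⟩
  have h_le : ∀ c, c < b ↔ c ≤ a := fun c => ⟨hab.le_of_lt, hab.lt.trans_le'⟩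
  simp only [Equiv.swap_apply_def]
  grind

theorem pairTerm_swap_mul {a b : Fin n} (hab : a ⋖ b) {p : Equiv.Perm (Fin n)}
    (s : Fin n → ℤˣ) (hlt : p.symm a < p.symm b) {c : Fin n × Fin n}
    (hc : c ≠ (p.symm a, p.symm b)) :
    pairTerm (Equiv.swap a b * p) s c = pairTerm p s c := by
  by_cases hc_lt : c.1 < c.2
  · have h_iff : Equiv.swap a b (p c.2) < Equiv.swap a b (p c.1) ↔ p c.2 < p c.1 := by
      refine swap_lt_swap_iff_of_covBy hab ?_ ?_
      · rintro ⟨rfl, rfl⟩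
        simp only [Equiv.symm_apply_apply] at hlt
        exact hlt.not_gt hc_lt
      · rintro ⟨rfl, rfl⟩
        simp at hc
    simp only [pairTerm, Equiv.Perm.mul_apply, h_iff]
  · simp only [pairTerm, hc_lt, if_false]

theorem pairInv_swap_mul_add {a b : Fin n} (hab : a ⋖ b) {p : Equiv.Perm (Fin n)}
    (s : Fin n → ℤˣ) (hlt : p.symm a < p.symm b) :
    pairInv (Equiv.swap a b * p) s + (if s (p.symm b) = -1 then 2 else 0) = pairInv p s + 1 := by
  have h_new : pairTerm (Equiv.swap a b * p) s (p.symm a, p.symm b) = 1 := by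
    simp [pairTerm, hlt, hab.lt]
  have h_old : pairTerm p s (p.symm a, p.symm b) = if s (p.symm b) = -1 then 2 else 0 := by
    simp [pairTerm, hlt, hab.le]
  have h_rest : ∀ c ∈ Finset.univ.erase (p.symm a, p.symm b),
      pairTerm (Equiv.swap a b * p) s c = pairTerm p s c :=
    fun c hc => pairTerm_swap_mul hab s hlt (Finset.ne_of_mem_erase hc)
  unfold pairInv
  rw [← Finset.add_sum_erase _ _ (Finset.mem_univ (p.symm a, p.symm b)),
    ← Finset.add_sum_erase _ (pairTerm p s) (Finset.mem_univ (p.symm a, p.symm b)),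
    Finset.sum_congr rfl h_rest, h_new, h_old]
  ring

theorem pairInv_swap_mul_add_one {a b : Fin n} (hab : a ⋖ b) {p : Equiv.Perm (Fin n)}
    (s : Fin n → ℤˣ) (hlt : p.symm b < p.symm a) :
    pairInv (Equiv.swap a b * p) s + 1 =
      pairInv p s + (if s (p.symm a) = -1 then 2 else 0) := by
  have h_symm : ∀ c, (Equiv.swap a b * p).symm c = p.symm (Equiv.swap a b c) := fun _ => rfl
  have h_back := pairInv_swap_mul_add hab (p := Equiv.swap a b * p) s (by simpa [h_symm] using hlt)
  rw [h_symm, Equiv.swap_apply_right, ← mul_assoc, Equiv.swap_mul_self, one_mul] at h_back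
  exact h_back.symm

theorem pairInv_update_symm_zero (p : Equiv.Perm (Fin n)) (s : Fin n → ℤˣ) {i : Fin n}
    (hi : i.val = 0) (t : ℤˣ) : pairInv p (Function.update s (p.symm i) t) = pairInv p s := by
  refine Finset.sum_congr rfl fun c _ => ?_
  by_cases hc : c.2 = p.symm i
  · have hinv : c.1 < c.2 → p c.2 < p c.1 := by
      intro hlt
      have hne : p c.1 ≠ i := by rintro rfl; simp [hc] at hlt
      rw [hc, Equiv.apply_symm_apply, Fin.lt_def, hi]
      exact Nat.pos_of_ne_zero fun h => hne (Fin.ext (h.trans hi.symm))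
    by_cases hlt : c.1 < c.2
    · simp only [pairTerm, hlt, hinv hlt, if_true]
    · simp only [pairTerm, hlt, if_false]
  · simp only [pairTerm, Function.update_of_ne hc]

/-! ### The two lengths -/

/-- The Coxeter generator `generator n i` as an element of the group. -/
def gen (i : Fin n) : hyperoctahedral n :=
  if i.val = 0 then ofPermSign 1 (Function.update 1 i (-1))
  else ofPermSign (Equiv.swap ⟨i.val - 1, lt_of_le_of_lt (Nat.sub_le _ _) i.isLt⟩ i) 1

theorem coe_gen (i : Fin n) : (gen i).1 = generator n i := by
  ext1 ⟨k, t⟩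
  rw [hyperoctahedral_apply]
  unfold gen generator
  split_ifs with h
  · rw [absPerm_ofPermSign, signAt_ofPermSign]
    rcases eq_or_ne k i with rfl | hk
    · rcases Int.units_eq_one_or t with rfl | rfl <;> simp
    · rw [Equiv.swap_apply_of_ne_of_ne] <;> simp [hk]
  · simp

theorem gen_mul_self (i : Fin n) : gen i * gen i = 1 := by
  apply Subtype.ext
  rw [Subgroup.coe_mul, coe_gen]
  unfold generator
  split_ifs
  · simp
  · ext1 ⟨k, t⟩; simp

theorem prod_generator_eq_iff (w : List (Fin n)) (σ : hyperoctahedral n) :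
    (w.map (generator n)).prod = σ.1 ↔ (w.map gen).prod = σ := by
  have h_coe : ((w.map gen).prod).1 = (w.map (generator n)).prod := by
    induction w with
    | nil => rfl
    | cons i w ih => simp [← ih, coe_gen]
  rw [← h_coe, Subtype.ext_iff]

theorem absPerm_gen_zero_mul {i : Fin n} (hi : i.val = 0) (σ : hyperoctahedral n) :
    absPerm (gen i * σ) = absPerm σ := by
  simp [absPerm_mul, gen, hi]

theorem signAt_gen_zero_mul {i : Fin n} (hi : i.val = 0) (σ : hyperoctahedral n) :
    signAt (gen i * σ) =
      Function.update (signAt σ) ((absPerm σ).symm i) (-signAt σ ((absPerm σ).symm i)) := by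
  ext1 k
  rw [signAt_mul]
  simp only [gen, hi, if_true, signAt_ofPermSign]
  rcases eq_or_ne k ((absPerm σ).symm i) with rfl | hk
  · simp
  · rw [Function.update_of_ne hk,
      Function.update_of_ne ((absPerm σ).eq_symm_apply.not.1 hk),
      Pi.one_apply, one_mul]

theorem gen_of_covBy {a b : Fin n} (hab : a ⋖ b) : gen b = ofPermSign (Equiv.swap a b) 1 := by
  have h_succ : a.val + 1 = b.val := Nat.covBy_iff_add_one_eq.1 (Fin.covBy_iff.1 hab)
  rw [gen, if_neg (by omega)]
  congr
  omega

theorem absPerm_gen_mul {a b : Fin n} (hab : a ⋖ b) (σ : hyperoctahedral n) :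
    absPerm (gen b * σ) = Equiv.swap a b * absPerm σ := by
  simp [absPerm_mul, gen_of_covBy hab]

theorem signAt_gen_mul {a b : Fin n} (hab : a ⋖ b) (σ : hyperoctahedral n) :
    signAt (gen b * σ) = signAt σ := by
  ext1 k
  simp [signAt_mul, gen_of_covBy hab]

theorem exists_covBy_of_val_ne_zero {i : Fin n} (hi : i.val ≠ 0) : ∃ a : Fin n, a ⋖ i :=
  ⟨⟨i.val - 1, by omega⟩,
    Fin.covBy_iff.2 (Nat.covBy_iff_add_one_eq.2 (Nat.succ_pred hi))⟩

theorem symm_ne_symm_of_covBy {a b : Fin n} (hab : a ⋖ b) (p : Equiv.Perm (Fin n)) :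
    p.symm a ≠ p.symm b :=
  p.symm.injective.ne hab.lt.ne

theorem negCount_gen_mul_le (i : Fin n) (σ : hyperoctahedral n) :
    negCount (signAt (gen i * σ)) ≤ negCount (signAt σ) + (if i.val = 0 then 1 else 0) := by
  by_cases hi : i.val = 0
  · have h_update := negCount_update_neg_one (signAt σ) ((absPerm σ).symm i)
    have h_self := Function.update_eq_self ((absPerm σ).symm i) (signAt σ)
    rw [signAt_gen_zero_mul hi, if_pos hi]
    rcases Int.units_eq_one_or (signAt σ ((absPerm σ).symm i)) with h | h <;> rw [h] at h_self ⊢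
    · rw [h_update, h_self]
    · rw [h_self] at h_update
      rw [neg_neg]
      omega
  · obtain ⟨a, hab⟩ := exists_covBy_of_val_ne_zero hi
    rw [signAt_gen_mul hab]
    exact Nat.le_add_right _ _

theorem pairInv_gen_mul_le (i : Fin n) (σ : hyperoctahedral n) :
    pairInv (absPerm (gen i * σ)) (signAt (gen i * σ)) ≤
      pairInv (absPerm σ) (signAt σ) + (if i.val ≠ 0 then 1 else 0) := by
  by_cases hi : i.val = 0
  · rw [absPerm_gen_zero_mul hi, signAt_gen_zero_mul hi, pairInv_update_symm_zero _ _ hi]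
    exact Nat.le_add_right _ _
  · obtain ⟨a, hab⟩ := exists_covBy_of_val_ne_zero hi
    rw [absPerm_gen_mul hab, signAt_gen_mul hab, if_pos hi]
    rcases (symm_ne_symm_of_covBy hab (absPerm σ)).lt_or_gt with h | h
    · have := pairInv_swap_mul_add hab (signAt σ) h
      omega
    · have := pairInv_swap_mul_add_one hab (signAt σ) h
      split_ifs at this <;> omega

theorem signAt_symm_eq_one_of_inversions_le {i : Fin n} (hi : i.val = 0) {σ : hyperoctahedral n}
    (h : inversions σ ≤ inversions (gen i * σ)) : signAt σ ((absPerm σ).symm i) = 1 := by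
  refine (Int.units_eq_one_or _).resolve_right fun hneg => ?_
  have h_update := negCount_update_neg_one (signAt σ) ((absPerm σ).symm i)
  rw [← hneg, Function.update_eq_self] at h_update
  unfold inversions at h
  rw [absPerm_gen_zero_mul hi, signAt_gen_zero_mul hi, pairInv_update_symm_zero _ _ hi, hneg,
    neg_neg] at h
  omega

theorem symm_lt_symm_and_signAt_eq_one_of_inversions_le {a b : Fin n} (hab : a ⋖ b)
    {σ : hyperoctahedral n} (h : inversions σ ≤ inversions (gen b * σ))
    (ha : signAt σ ((absPerm σ).symm a) = 1) :
    (absPerm σ).symm a < (absPerm σ).symm b ∧ signAt σ ((absPerm σ).symm b) = 1 := by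
  unfold inversions at h
  rw [absPerm_gen_mul hab, signAt_gen_mul hab] at h
  rcases (symm_ne_symm_of_covBy hab (absPerm σ)).lt_or_gt with hlt | hlt
  · refine ⟨hlt, (Int.units_eq_one_or _).resolve_right fun hneg => ?_⟩
    have h_swap := pairInv_swap_mul_add hab (signAt σ) hlt
    rw [if_pos hneg] at h_swap
    omega
  · have h_swap := pairInv_swap_mul_add_one hab (signAt σ) hlt
    rw [if_neg (by rw [ha]; decide)] at h_swap
    omega

theorem signAt_symm_eq_one_of_forall_inversions_le {σ : hyperoctahedral n}
    (h : ∀ i, inversions σ ≤ inversions (gen i * σ)) (i : Fin n) :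
    signAt σ ((absPerm σ).symm i) = 1 := by
  induction i using WellFoundedLT.induction with
  | _ i ih =>
    by_cases hi : i.val = 0
    · exact signAt_symm_eq_one_of_inversions_le hi (h i)
    · obtain ⟨a, hab⟩ := exists_covBy_of_val_ne_zero hi
      exact (symm_lt_symm_and_signAt_eq_one_of_inversions_le hab (h i) (ih a hab.lt)).2

theorem eq_one_of_forall_inversions_le {σ : hyperoctahedral n}
    (h : ∀ i, inversions σ ≤ inversions (gen i * σ)) : σ = 1 := by
  have h_sign := signAt_symm_eq_one_of_forall_inversions_le h
  have h_mono : StrictMono (absPerm σ).symm :=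
    (strictMono_iff_forall_covBy _).2 fun _ b hab =>
      (symm_lt_symm_and_signAt_eq_one_of_inversions_le hab (h b) (h_sign _)).1
  have h_symm : (absPerm σ).symm = 1 := DFunLike.coe_injective h_mono.eq_id
  refine hyperoctahedral_ext (inv_eq_one.1 h_symm) (funext fun k => ?_)
  simpa using h_sign (absPerm σ k)

theorem exists_word_length_le (σ : hyperoctahedral n) :
    ∃ w : List (Fin n), (w.map gen).prod = σ ∧ w.length ≤ inversions σ := by
  induction hN : inversions σ using Nat.strong_induction_on generalizing σ with
  | _ N ih =>
    by_cases h : ∀ i, inversions σ ≤ inversions (gen i * σ)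
    · exact ⟨[], by simp [eq_one_of_forall_inversions_le h], by simp⟩
    · push Not at h
      obtain ⟨i, h_descent⟩ := h
      obtain ⟨w, hw, h_length⟩ := ih _ (hN ▸ h_descent) (gen i * σ) rfl
      refine ⟨i :: w, ?_, by rw [List.length_cons]; omega⟩
      rw [List.map_cons, List.prod_cons, hw, ← mul_assoc, gen_mul_self, one_mul]

theorem negCount_prod_le_countP (w : List (Fin n)) :
    negCount (signAt (w.map gen).prod) ≤ w.countP (fun i => i.val = 0) := by
  induction w with
  | nil => exact negCount_one.le
  | cons i w ih =>
    have := negCount_gen_mul_le i (w.map gen).prod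
    simp only [List.map_cons, List.prod_cons, List.countP_cons, decide_eq_true_eq]
    omega

theorem pairInv_prod_le_countP (w : List (Fin n)) :
    pairInv (absPerm (w.map gen).prod) (signAt (w.map gen).prod) ≤
      w.countP (fun i => i.val ≠ 0) := by
  induction w with
  | nil => exact pairInv_one.le
  | cons i w ih =>
    have := pairInv_gen_mul_le i (w.map gen).prod
    simp only [List.map_cons, List.prod_cons, List.countP_cons, decide_eq_true_eq]
    omega

theorem length_eq_countP_zero_add_countP_ne_zero (w : List (Fin n)) :
    w.length = w.countP (fun i => i.val = 0) + w.countP (fun i => i.val ≠ 0) := by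
  simpa using w.length_eq_countP_add_countP (fun i => decide (i.val = 0))

theorem inversions_le_length {w : List (Fin n)} {σ : hyperoctahedral n}
    (hw : (w.map gen).prod = σ) : inversions σ ≤ w.length := by
  subst hw
  rw [length_eq_countP_zero_add_countP_ne_zero]
  exact add_le_add (negCount_prod_le_countP w) (pairInv_prod_le_countP w)

theorem exists_isReducedWord (σ : hyperoctahedral n) : ∃ w, IsReducedWord w σ := by
  obtain ⟨w, hw, h_length⟩ := exists_word_length_le σ
  exact ⟨w, (prod_generator_eq_iff _ _).2 hw, fun w' hw' =>
    h_length.trans (inversions_le_length ((prod_generator_eq_iff _ _).1 hw'))⟩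

theorem countP_of_isReducedWord {w : List (Fin n)} {σ : hyperoctahedral n}
    (hw : IsReducedWord w σ) :
    w.countP (fun i => i.val = 0) = negCount (signAt σ) ∧
      w.countP (fun i => i.val ≠ 0) = pairInv (absPerm σ) (signAt σ) := by
  obtain ⟨w', hw', h_length⟩ := exists_word_length_le σ
  have h_min := hw.2 w' ((prod_generator_eq_iff _ _).2 hw')
  obtain rfl := (prod_generator_eq_iff _ _).1 hw.1
  have h_zero := negCount_prod_le_countP w
  have h_ne_zero := pairInv_prod_le_countP w
  rw [length_eq_countP_zero_add_countP_ne_zero] at h_min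
  unfold inversions at h_length
  omega

theorem length₁_eq_negCount (σ : hyperoctahedral n) : length₁ σ = negCount (signAt σ) := by
  obtain ⟨w₀, hw₀⟩ := exists_isReducedWord σ
  obtain ⟨w, hw, h_eq⟩ := Nat.sInf_mem
    (s := {k | ∃ w, IsReducedWord w σ ∧ k = w.countP (fun i => i.val = 0)}) ⟨_, w₀, hw₀, rfl⟩
  exact h_eq.trans (countP_of_isReducedWord hw).1

theorem length₂_eq_pairInv (σ : hyperoctahedral n) :
    length₂ σ = pairInv (absPerm σ) (signAt σ) := by
  obtain ⟨w₀, hw₀⟩ := exists_isReducedWord σ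
  obtain ⟨w, hw, h_eq⟩ := Nat.sInf_mem
    (s := {k | ∃ w, IsReducedWord w σ ∧ k = w.countP (fun i => i.val ≠ 0)}) ⟨_, w₀, hw₀, rfl⟩
  exact h_eq.trans (countP_of_isReducedWord hw).2

theorem eq_one_of_length_eq_zero {σ : hyperoctahedral n} (h₁ : length₁ σ = 0)
    (h₂ : length₂ σ = 0) : σ = 1 := by
  rw [length₁_eq_negCount] at h₁
  rw [length₂_eq_pairInv] at h₂
  exact eq_one_of_forall_inversions_le fun i => by simp [inversions, h₁, h₂]

end SignedPerm

/-! ### Positivity of the length kernel -/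

section ProductKernel

variable {W ι : Type*} [Fintype ι]

/-- The kernel on `W` in which every character `e h` on which two points of `W` differ
contributes the factor `c h`. -/
def productKernel (e : ι → W → ℤˣ) (c : ι → ℝ) : Matrix W W ℝ :=
  Matrix.of fun σ τ => ∏ h, if e h σ = e h τ then 1 else c h

/-- The values of the products of characters, indexed by the sets of factors. -/
def characterMatrix (e : ι → W → ℤˣ) : Matrix (Finset ι) W ℝ :=
  Matrix.of fun S σ => ∏ h ∈ S, ((e h σ : ℤ) : ℝ)

theorem units_mul_self_cast (u : ℤˣ) : ((u : ℤ) : ℝ) * ((u : ℤ) : ℝ) = 1 := by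
  exact_mod_cast congrArg (Int.cast : ℤ → ℝ) (Int.units_coe_mul_self u)

theorem units_mul_cast_of_ne {u v : ℤˣ} (h : u ≠ v) : ((u : ℤ) : ℝ) * ((v : ℤ) : ℝ) = -1 := by
  rw [Int.units_ne_iff_eq_neg.1 h]
  push_cast
  rw [neg_mul, units_mul_self_cast]

theorem characterMatrix_transpose_mul_self [DecidableEq W] {e : ι → W → ℤˣ}
    (h_sep : ∀ σ τ, (∀ h, e h σ = e h τ) → σ = τ) :
    (characterMatrix e).transpose * characterMatrix e =
      (2 : ℝ) ^ Fintype.card ι • (1 : Matrix W W ℝ) := by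
  ext σ τ
  have h_prod : ((characterMatrix e).transpose * characterMatrix e) σ τ =
      ∏ h, (1 + ((e h σ : ℤ) : ℝ) * ((e h τ : ℤ) : ℝ)) := by
    rw [Finset.prod_one_add, Finset.powerset_univ, Matrix.mul_apply]
    simp only [characterMatrix, Matrix.transpose_apply, Matrix.of_apply, Finset.prod_mul_distrib]
  rw [h_prod, Matrix.smul_apply]
  rcases eq_or_ne σ τ with rfl | hne
  · simp only [units_mul_self_cast, Matrix.one_apply_eq, one_add_one_eq_two, Finset.prod_const,
      Finset.card_univ, smul_eq_mul, mul_one]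
  · obtain ⟨h, hh⟩ : ∃ h, e h σ ≠ e h τ := by
      by_contra! h_eq
      exact hne (h_sep σ τ h_eq)
    rw [Matrix.one_apply_ne hne, smul_zero]
    exact Finset.prod_eq_zero (Finset.mem_univ h) (by rw [units_mul_cast_of_ne hh]; norm_num)

theorem productKernel_eq_transpose_mul_diagonal_mul [DecidableEq ι] (e : ι → W → ℤˣ) (c : ι → ℝ) :
    productKernel e c = (characterMatrix e).transpose *
      Matrix.diagonal (fun S : Finset ι => (∏ h ∈ S, (1 - c h) / 2) * ∏ h ∈ Sᶜ, (1 + c h) / 2) *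
      characterMatrix e := by
  ext σ τ
  have h_factor : ∀ h, (if e h σ = e h τ then 1 else c h) =
      (1 - c h) / 2 * (((e h σ : ℤ) : ℝ) * ((e h τ : ℤ) : ℝ)) + (1 + c h) / 2 := by
    intro h
    split_ifs with heq
    · rw [heq, units_mul_self_cast]; ring
    · rw [units_mul_cast_of_ne heq]; ring
  simp only [productKernel, Matrix.of_apply, h_factor]
  rw [Finset.prod_add, Finset.powerset_univ, Matrix.mul_apply]
  refine Finset.sum_congr rfl fun S _ => ?_
  simp only [Matrix.mul_diagonal, Matrix.transpose_apply, characterMatrix, Matrix.of_apply,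
    Finset.prod_mul_distrib, Finset.compl_eq_univ_sdiff]
  ring

theorem posDef_productKernel [Finite W] {e : ι → W → ℤˣ}
    (h_sep : ∀ σ τ, (∀ h, e h σ = e h τ) → σ = τ) {c : ι → ℝ}
    (hc : ∀ h, c h ∈ Set.Ioo (-1 : ℝ) 1) : (productKernel e c).PosDef := by
  classical
  cases nonempty_fintype W
  rw [productKernel_eq_transpose_mul_diagonal_mul, ← Matrix.conjTranspose_eq_transpose_of_trivial]
  refine Matrix.PosDef.conjTranspose_mul_mul_same (Matrix.PosDef.diagonal fun S => ?_) ?_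
  · exact mul_pos (Finset.prod_pos fun h _ => by linarith [(hc h).2])
      (Finset.prod_pos fun h _ => by linarith [(hc h).1])
  · refine Function.Injective.of_comp (f := (characterMatrix e).transpose.mulVec) fun v w hvw => ?_
    simp only [Function.comp_apply, Matrix.mulVec_mulVec, characterMatrix_transpose_mul_self h_sep,
      Matrix.smul_mulVec, Matrix.one_mulVec] at hvw
    exact smul_right_injective _ (by positivity : (2 : ℝ) ^ Fintype.card ι ≠ 0) hvw

end ProductKernel

theorem exists_mul_sum_smul_eq_one {G K A : Type*} [Group G] [Fintype G] [DecidableEq G]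
    [CommRing K] [Ring A] [Algebra K A] (ρ : G →* A) {φ : G → K}
    (hφ : IsUnit (Matrix.of fun σ τ => φ (σ * τ⁻¹))) : ∃ a : A, a * ∑ σ, φ σ • ρ σ = 1 := by
  obtain ⟨N, hN⟩ := hφ.exists_left_inv
  refine ⟨∑ σ, N 1 σ • ρ σ⁻¹, ?_⟩
  have h_row : ∀ σ, (N 1 σ • ρ σ⁻¹) * ∑ g, φ g • ρ g =
      ∑ τ, (N 1 σ * φ (σ * τ⁻¹)) • ρ τ⁻¹ := by
    intro σ
    rw [Finset.mul_sum, ← Equiv.sum_comp ((Equiv.inv G).trans (Equiv.mulLeft σ))]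
    refine Finset.sum_congr rfl fun τ _ => ?_
    simp [smul_smul, ← map_mul, mul_comm (φ _)]
  calc (∑ σ, N 1 σ • ρ σ⁻¹) * ∑ g, φ g • ρ g
      = ∑ τ, (N * Matrix.of fun σ τ => φ (σ * τ⁻¹)) 1 τ • ρ τ⁻¹ := by
        simp only [Finset.sum_mul, h_row, Matrix.mul_apply, Matrix.of_apply, Finset.sum_smul]
        exact Finset.sum_comm
    _ = 1 := by simp [hN, Matrix.one_apply]

section Hyperplanes

variable {n : ℕ}

/-- The integer `±(k + 1)` encoded by `(k, ±1)`. -/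
def signedVal (a : Fin n × ℤˣ) : ℤ := (a.2 : ℤ) * (a.1.val + 1)

theorem signedVal_neg (i : Fin n) (s : ℤˣ) : signedVal (i, -s) = -signedVal (i, s) := by
  simp [signedVal]

theorem signedVal_injective : Function.Injective (signedVal (n := n)) := by
  rintro ⟨i, s⟩ ⟨j, t⟩ h
  rcases Int.units_eq_one_or s with rfl | rfl <;> rcases Int.units_eq_one_or t with rfl | rfl <;>
    simp only [signedVal, Units.val_one, Units.val_neg, Prod.mk.injEq, Fin.ext_iff] at h ⊢ <;>
    first | exact ⟨by omega, trivial⟩ | omega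

/-- The sign that records in which order `σ` arranges the points `a` and `b` of
`{±1, …, ±n}`. -/
def orderSign (a b : Fin n × ℤˣ) (σ : hyperoctahedral n) : ℤˣ :=
  if signedVal (σ.1 a) < signedVal (σ.1 b) then 1 else -1

theorem orderSign_comm {a b : Fin n × ℤˣ} (h : a ≠ b) (σ : hyperoctahedral n) :
    orderSign a b σ = -orderSign b a σ := by
  have hne : signedVal (σ.1 a) ≠ signedVal (σ.1 b) :=
    (signedVal_injective.comp σ.1.injective).ne h
  unfold orderSign
  rcases hne.lt_or_gt with hlt | hlt <;> simp [hlt, hlt.not_gt]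

theorem orderSign_neg_neg (i j : Fin n) (s t : ℤˣ) (σ : hyperoctahedral n) :
    orderSign (i, -s) (j, -t) σ = orderSign (j, t) (i, s) σ := by
  simp only [orderSign, hyperoctahedral_apply, mul_neg, signedVal_neg, neg_lt_neg_iff]

/-- The indicator of `a` and `b` being arranged differently by `σ` and by `τ`. -/
def disagreement (σ τ : hyperoctahedral n) (a b : Fin n × ℤˣ) : ℕ :=
  if orderSign a b σ ≠ orderSign a b τ then 1 else 0

theorem disagreement_comm (σ τ : hyperoctahedral n) (a b : Fin n × ℤˣ) :
    disagreement σ τ a b = disagreement σ τ b a := by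
  rcases eq_or_ne a b with rfl | h
  · rfl
  · simp only [disagreement, orderSign_comm h, ne_eq, neg_inj]

theorem disagreement_neg_neg (σ τ : hyperoctahedral n) (i j : Fin n) (s t : ℤˣ) :
    disagreement σ τ (i, -s) (j, -t) = disagreement σ τ (i, s) (j, t) := by
  rw [disagreement_comm σ τ (i, s)]
  simp only [disagreement, orderSign_neg_neg]

theorem sum_units {M : Type*} [AddCommMonoid M] (f : ℤˣ → M) : ∑ s, f s = f 1 + f (-1) := by
  rw [UnitsInt.univ, Finset.sum_pair (by decide)]

theorem sum_ne_eq_two_mul_sum_lt {ι M : Type*} [Fintype ι] [LinearOrder ι] [NonAssocSemiring M]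
    {f : ι → ι → M} (hf : ∀ i j, f i j = f j i) :
    (∑ i, ∑ j, if i ≠ j then f i j else 0) = 2 * ∑ i, ∑ j, if i < j then f i j else 0 := by
  have h_split : ∀ i j, (if i ≠ j then f i j else 0) =
      (if i < j then f i j else 0) + (if j < i then f j i else 0) := by
    intro i j
    rcases lt_trichotomy i j with h | rfl | h
    · simp [h, h.ne, h.not_gt]
    · simp
    · simp [h, h.ne', h.not_gt, hf i j]
  simp only [h_split, Finset.sum_add_distrib]
  rw [Finset.sum_comm (f := fun i j => if j < i then f j i else 0), two_mul]

theorem sum_disagreement_comm (σ τ : hyperoctahedral n) (i j : Fin n) :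
    ∑ t, disagreement σ τ (j, 1) (i, t) = ∑ t, disagreement σ τ (i, 1) (j, t) := by
  rw [sum_units, sum_units, disagreement_comm σ τ (j, 1) (i, 1),
    ← disagreement_neg_neg σ τ j i 1 (-1), neg_neg, disagreement_comm σ τ (j, -1)]

theorem sum_sum_disagreement (σ τ : hyperoctahedral n) (i j : Fin n) :
    ∑ s, ∑ t, disagreement σ τ (j, s) (i, t) = 2 * ∑ t, disagreement σ τ (j, 1) (i, t) := by
  simp only [sum_units]
  rw [disagreement_neg_neg σ τ j i 1 1, ← disagreement_neg_neg σ τ j i 1 (-1), neg_neg]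
  ring

/-- The reflection hyperplanes of type B: `inl k` is `x_k = 0` and `inr (i, j, t)`, where `i < j`,
is `x_j = t x_i`. -/
abbrev Hyperplane (n : ℕ) : Type := Fin n ⊕ {b : Fin n × Fin n × ℤˣ // b.1 < b.2.1}

/-- The side of a reflection hyperplane on which the chamber of a signed permutation lies. -/
def side : Hyperplane n → hyperoctahedral n → ℤˣ
  | .inl k, σ => signAt σ k
  | .inr b, σ => orderSign (b.1.2.1, 1) (b.1.1, b.1.2.2) σ

/-- The number of hyperplanes `x_k = 0` that separate two signed permutations. -/
def signSeparation (σ τ : hyperoctahedral n) : ℕ :=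
  Finset.card {k | side (.inl k) σ ≠ side (.inl k) τ}

/-- The number of hyperplanes `x_j = ± x_i` that separate two signed permutations. -/
def pairSeparation (σ τ : hyperoctahedral n) : ℕ :=
  Finset.card {b | side (.inr b) σ ≠ side (.inr b) τ}

theorem signSeparation_mul_right (σ τ ρ : hyperoctahedral n) :
    signSeparation (σ * ρ) (τ * ρ) = signSeparation σ τ := by
  unfold signSeparation
  refine Finset.card_equiv (absPerm ρ) fun k => ?_
  rw [Finset.mem_filter_univ, Finset.mem_filter_univ]
  simp only [side, signAt_mul, ne_eq, mul_left_inj]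

theorem signSeparation_one (σ : hyperoctahedral n) :
    signSeparation σ 1 = negCount (signAt σ) := by
  refine congrArg Finset.card (Finset.filter_congr fun k _ => ?_)
  rw [side, side, signAt_one, Int.units_ne_iff_eq_neg]

theorem pairSeparation_eq_sum (σ τ : hyperoctahedral n) :
    pairSeparation σ τ =
      ∑ i : Fin n, ∑ j : Fin n, if i < j then ∑ t, disagreement σ τ (j, 1) (i, t) else 0 := by
  rw [pairSeparation, Finset.card_filter]
  calc (∑ b : {b : Fin n × Fin n × ℤˣ // b.1 < b.2.1},
        if side (.inr b) σ ≠ side (.inr b) τ then 1 else 0)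
      = ∑ b : Fin n × Fin n × ℤˣ with b.1 < b.2.1,
          disagreement σ τ (b.2.1, 1) (b.1, b.2.2) := by
        rw [← Finset.sum_subtype_eq_sum_filter, Finset.subtype_univ]
        rfl
    _ = _ := by
        simp only [Finset.sum_filter, Fintype.sum_prod_type, Finset.sum_ite_irrel,
          Finset.sum_const_zero]

theorem four_mul_pairSeparation (σ τ : hyperoctahedral n) :
    4 * pairSeparation σ τ =
      ∑ a : Fin n × ℤˣ, ∑ b : Fin n × ℤˣ, if a.1 ≠ b.1 then disagreement σ τ a b else 0 := by
  have h_signs : ∀ i j, (∑ s : ℤˣ, ∑ t : ℤˣ, if i ≠ j then disagreement σ τ (i, s) (j, t) else 0) =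
      2 * if i ≠ j then ∑ t, disagreement σ τ (j, 1) (i, t) else 0 := by
    intro i j
    split_ifs
    · rw [sum_sum_disagreement, sum_disagreement_comm]
    · simp
  simp only [Fintype.sum_prod_type]
  calc 4 * pairSeparation σ τ
      = 2 * ∑ i, ∑ j, if i ≠ j then ∑ t, disagreement σ τ (j, 1) (i, t) else 0 := by
        rw [sum_ne_eq_two_mul_sum_lt (fun i j => sum_disagreement_comm σ τ i j),
          ← pairSeparation_eq_sum]
        ring
    _ = _ := by
        simp only [Finset.mul_sum, ← h_signs]
        exact Finset.sum_congr rfl fun i _ => Finset.sum_comm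

theorem pairSeparation_mul_right (σ τ ρ : hyperoctahedral n) :
    pairSeparation (σ * ρ) (τ * ρ) = pairSeparation σ τ := by
  refine Nat.eq_of_mul_eq_mul_left four_pos ?_
  rw [four_mul_pairSeparation, four_mul_pairSeparation, eq_comm, ← Equiv.sum_comp ρ.1]
  refine Finset.sum_congr rfl fun a _ => ?_
  rw [← Equiv.sum_comp ρ.1]
  refine Finset.sum_congr rfl fun b _ => ?_
  have h_fst : (ρ.1 a).1 ≠ (ρ.1 b).1 ↔ a.1 ≠ b.1 := by
    simp [hyperoctahedral_apply ρ a.1, hyperoctahedral_apply ρ b.1]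
  simp only [h_fst]
  rfl

theorem disagreement_one (σ : hyperoctahedral n) {i j : Fin n} (hij : i < j) (t : ℤˣ) :
    disagreement σ 1 (j, 1) (i, t) =
      if signedVal (σ.1 (j, 1)) < signedVal (σ.1 (i, t)) then 1 else 0 := by
  have h_one : orderSign (j, 1) (i, t) 1 = -1 := by
    have : i.val < j.val := hij
    refine if_neg ?_
    rcases Int.units_eq_one_or t with rfl | rfl <;> simp [signedVal] <;> omega
  rw [disagreement, h_one, orderSign]
  split_ifs <;> simp_all

theorem sum_disagreement_one (σ : hyperoctahedral n) {i j : Fin n} (hij : i < j) :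
    ∑ t, disagreement σ 1 (j, 1) (i, t) = pairTerm (absPerm σ) (signAt σ) (i, j) := by
  have h_ne : (absPerm σ i).val ≠ (absPerm σ j).val :=
    fun h => hij.ne ((absPerm σ).injective (Fin.ext h))
  simp only [sum_units, disagreement_one σ hij, hyperoctahedral_apply, signedVal, pairTerm,
    hij, if_true, mul_one, mul_neg, Fin.lt_def]
  rcases Int.units_eq_one_or (signAt σ i) with h | h <;>
    rcases Int.units_eq_one_or (signAt σ j) with h' | h' <;>
    simp only [h, h', Units.val_neg, Units.val_one, if_true, if_false,
      show (1 : ℤˣ) ≠ -1 by decide] <;>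
    split_ifs <;> omega

theorem pairSeparation_one (σ : hyperoctahedral n) :
    pairSeparation σ 1 = pairInv (absPerm σ) (signAt σ) := by
  rw [pairSeparation_eq_sum, pairInv, Fintype.sum_prod_type]
  refine Finset.sum_congr rfl fun i _ => Finset.sum_congr rfl fun j _ => ?_
  split_ifs with hij
  · exact sum_disagreement_one σ hij
  · simp [pairTerm, hij]

theorem length₁_mul_inv (σ τ : hyperoctahedral n) : length₁ (σ * τ⁻¹) = signSeparation σ τ := by
  rw [length₁_eq_negCount, ← signSeparation_one, ← signSeparation_mul_right _ _ τ,
    inv_mul_cancel_right, one_mul]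

theorem length₂_mul_inv (σ τ : hyperoctahedral n) : length₂ (σ * τ⁻¹) = pairSeparation σ τ := by
  rw [length₂_eq_pairInv, ← pairSeparation_one, ← pairSeparation_mul_right _ _ τ,
    inv_mul_cancel_right, one_mul]

theorem eq_of_forall_side_eq {σ τ : hyperoctahedral n} (h : ∀ b, side b σ = side b τ) :
    σ = τ := by
  refine mul_inv_eq_one.1 (eq_one_of_length_eq_zero ?_ ?_)
  · simp [length₁_mul_inv, signSeparation, h]
  · simp [length₂_mul_inv, pairSeparation, h]

theorem lengthKernel_eq_productKernel (α q : ℝ) :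
    (Matrix.of fun σ τ : hyperoctahedral n => α ^ length₁ (σ * τ⁻¹) * q ^ length₂ (σ * τ⁻¹)) =
      productKernel side (Sum.elim (fun _ => α) (fun _ => q)) := by
  ext σ τ
  rw [Matrix.of_apply, length₁_mul_inv, length₂_mul_inv, productKernel, Matrix.of_apply,
    Fintype.prod_sum_type]
  simp only [Sum.elim_inl, Sum.elim_inr, Finset.prod_ite, Finset.prod_const, one_pow, one_mul]
  rfl

theorem isUnit_lengthKernel {α q : ℝ} (hα : α ∈ Set.Ioo (-1 : ℝ) 1)
    (hq : q ∈ Set.Ioo (-1 : ℝ) 1) :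
    IsUnit (Matrix.of fun σ τ : hyperoctahedral n =>
      (α : ℂ) ^ length₁ (σ * τ⁻¹) * (q : ℂ) ^ length₂ (σ * τ⁻¹)) := by
  classical
  have h_pos : (productKernel side (Sum.elim (fun _ => α) (fun _ => q)) :
      Matrix (hyperoctahedral n) (hyperoctahedral n) ℝ).PosDef :=
    posDef_productKernel (fun _ _ => eq_of_forall_side_eq) (by rintro (_ | _) <;> assumption)
  rw [← lengthKernel_eq_productKernel] at h_pos
  convert h_pos.isUnit.map Complex.ofRealHom.mapMatrix
  ext σ τ
  simp

end Hyperplanes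

/-! ### Nondegeneracy of the inner products -/

section Nondegenerate

variable {H : Type*} [NormedAddCommGroup H] [InnerProductSpace ℂ H]

theorem exists_finiteDimensional_mem_span_tprod (n : ℕ) (t : ⨂[ℂ]^n H) :
    ∃ E : Submodule ℂ H, FiniteDimensional ℂ E ∧
      t ∈ Submodule.span ℂ (PiTensorProduct.tprod ℂ '' {v : Fin n → H | ∀ i, v i ∈ E}) := by
  induction t using PiTensorProduct.induction_on with
  | smul_tprod r v =>
    exact ⟨Submodule.span ℂ (Set.range v), FiniteDimensional.span_of_finite ℂ (Set.finite_range v),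
      Submodule.smul_mem _ _ (Submodule.subset_span
        ⟨v, fun i => Submodule.subset_span ⟨i, rfl⟩, rfl⟩)⟩
  | add a b ha hb =>
    obtain ⟨E, hE, ha⟩ := ha
    obtain ⟨F, hF, hb⟩ := hb
    have h_mono {E' : Submodule ℂ H} (h : E' ≤ E ⊔ F) :
        {v : Fin n → H | ∀ i, v i ∈ E'} ⊆ {v | ∀ i, v i ∈ E ⊔ F} := fun _ hv i => h (hv i)
    exact ⟨E ⊔ F, inferInstance, Submodule.add_mem _
      (Submodule.span_mono (Set.image_mono (h_mono le_sup_left)) ha)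
      (Submodule.span_mono (Set.image_mono (h_mono le_sup_right)) hb)⟩

theorem eq_sum_tensorInner_smul_tprod {ι : Type*} [Fintype ι] {E : Submodule ℂ H}
    (e : OrthonormalBasis ι ℂ E) {n : ℕ} {t : ⨂[ℂ]^n H}
    (ht : t ∈ Submodule.span ℂ (PiTensorProduct.tprod ℂ '' {v : Fin n → H | ∀ i, v i ∈ E})) :
    t = ∑ I : Fin n → ι, tensorInner n (PiTensorProduct.tprod ℂ fun k => (e (I k) : H)) t •
      PiTensorProduct.tprod ℂ fun k => (e (I k) : H) := by
  classical
  induction ht using Submodule.span_induction with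
  | mem u hu =>
    obtain ⟨v, hv, rfl⟩ := hu
    have h_expand : v = fun i => ∑ j, ⟪(e j : H), v i⟫_ℂ • (e j : H) := by
      ext1 i
      simpa using congrArg Subtype.val (e.sum_repr' ⟨v i, hv i⟩).symm
    conv_lhs => rw [h_expand, MultilinearMap.map_sum]
    refine Finset.sum_congr rfl fun I _ => ?_
    rw [MultilinearMap.map_smul_univ, tensorInner_tprod]
  | zero => simp
  | add a b _ _ ha hb =>
    simp only [map_add, add_smul, Finset.sum_add_distrib]
    rw [← ha, ← hb]
  | smul c a _ ha =>
    simp only [map_smul, smul_assoc, ← Finset.smul_sum]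
    rw [← ha]

theorem eq_zero_of_forall_tensorInner_tprod_eq_zero {n : ℕ} {t : ⨂[ℂ]^n H}
    (h : ∀ v : Fin n → H, tensorInner n (PiTensorProduct.tprod ℂ v) t = 0) : t = 0 := by
  obtain ⟨E, hE, ht⟩ := exists_finiteDimensional_mem_span_tprod n t
  rw [eq_sum_tensorInner_smul_tprod (stdOrthonormalBasis ℂ E) ht]
  simp [h]

/-- The identity for the sign `1` and the involution `J` for the sign `-1`. -/
def signMap (J : H →ₗ[ℂ] H) (s : ℤˣ) : H →ₗ[ℂ] H := if s = 1 then LinearMap.id else J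

@[simp] theorem signMap_one (J : H →ₗ[ℂ] H) : signMap J 1 = LinearMap.id := if_pos rfl

@[simp] theorem signMap_neg_one (J : H →ₗ[ℂ] H) : signMap J (-1) = J := if_neg (by decide)

theorem signMap_mul {J : H →ₗ[ℂ] H} (hJ : Function.Involutive J) (s t : ℤˣ) (z : H) :
    signMap J (s * t) z = signMap J s (signMap J t z) := by
  rcases Int.units_eq_one_or s with rfl | rfl <;> rcases Int.units_eq_one_or t with rfl | rfl <;>
    simp [hJ z]

theorem groupAction_tprod_eq_signMap (J : H →ₗ[ℂ] H) {n : ℕ} (σ : hyperoctahedral n)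
    (x : Fin n → H) :
    groupAction J σ (PiTensorProduct.tprod ℂ x) = PiTensorProduct.tprod ℂ fun j =>
      signMap J (signAt σ ((absPerm σ).symm j)) (x ((absPerm σ).symm j)) :=
  groupAction_tprod J σ x

/-- The action of the Coxeter group of type B on `H^{⊗ n}` as a representation. -/
def groupActionHom {J : H →ₗ[ℂ] H} (hJ : Function.Involutive J) (n : ℕ) :
    hyperoctahedral n →* Module.End ℂ (⨂[ℂ]^n H) where
  toFun := groupAction J
  map_one' := by
    refine PiTensorProduct.ext (MultilinearMap.ext fun x => ?_)
    simp only [LinearMap.compMultilinearMap_apply, groupAction_tprod_eq_signMap, absPerm_one,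
      signAt_one, signMap_one, Module.End.one_apply]
    rfl
  map_mul' σ τ := by
    refine PiTensorProduct.ext (MultilinearMap.ext fun x => ?_)
    have h_symm : ∀ j, (absPerm (σ * τ)).symm j = (absPerm τ).symm ((absPerm σ).symm j) := by
      intro j
      rw [absPerm_mul]
      rfl
    simp only [LinearMap.compMultilinearMap_apply, Module.End.mul_apply,
      groupAction_tprod_eq_signMap, h_symm, signAt_mul, Equiv.apply_symm_apply, signMap_mul hJ]

theorem symmetrizer_injective {J : H →ₗ[ℂ] H} (hJ : Function.Involutive J) {α q : ℝ}
    (hα : α ∈ Set.Ioo (-1 : ℝ) 1) (hq : q ∈ Set.Ioo (-1 : ℝ) 1) (n : ℕ) :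
    Function.Injective (symmetrizer J α q n) := by
  classical
  obtain ⟨A, hA⟩ := exists_mul_sum_smul_eq_one (groupActionHom hJ n)
    (φ := fun σ => (α : ℂ) ^ length₁ σ * (q : ℂ) ^ length₂ σ) (isUnit_lengthKernel hα hq)
  exact Function.LeftInverse.injective (g := A) (LinearMap.congr_fun hA)

theorem fockInner_lof (J : H →ₗ[ℂ] H) (α q : ℝ) {n : ℕ} (f : ⨂[ℂ]^n H) (g : Fock H) :
    fockInner J α q (DirectSum.lof ℂ ℕ (fun n => ⨂[ℂ]^n H) n f) g =
      tensorInner n f (symmetrizer J α q n (g n)) := by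
  unfold fockInner
  induction g using DirectSum.induction_on with
  | zero => simp
  | of m y =>
    rw [← DirectSum.lof_eq_of ℂ, DirectSum.toModule_lof]
    rcases eq_or_ne n m with rfl | h
    · simp [DirectSum.lof_apply]
    · rw [DirectSum.lof_eq_of, DirectSum.lof_eq_of, DirectSum.of_eq_of_ne _ _ _ h.symm,
        DirectSum.of_eq_of_ne _ _ _ h]
      simp
  | add a b ha hb => rw [map_add, ha, hb, DirectSum.add_apply, map_add, map_add]

theorem fockInner_add_left (J : H →ₗ[ℂ] H) (α q : ℝ) (f f' g : Fock H) :
    fockInner J α q (f + f') g = fockInner J α q f g + fockInner J α q f' g := by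
  unfold fockInner
  rw [← LinearMap.add_apply]
  congr 1
  ext
  simp

theorem fockInner_zero_left (J : H →ₗ[ℂ] H) (α q : ℝ) (g : Fock H) :
    fockInner J α q 0 g = 0 := by
  simpa using fockInner_add_left J α q 0 0 g

theorem eq_of_forall_fockInner_eq {J : H →ₗ[ℂ] H} (hJ : Function.Involutive J) {α q : ℝ}
    (hα : α ∈ Set.Ioo (-1 : ℝ) 1) (hq : q ∈ Set.Ioo (-1 : ℝ) 1) {g g' : Fock H}
    (h : ∀ f, fockInner J α q f g = fockInner J α q f g') : g = g' := by
  refine DFinsupp.ext fun n => symmetrizer_injective hJ hα hq n (sub_eq_zero.1 ?_)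
  refine eq_zero_of_forall_tensorInner_tprod_eq_zero fun v => ?_
  rw [map_sub, ← fockInner_lof, ← fockInner_lof, h, sub_self]

theorem IsCreationAdjoint.unique {J : H →ₗ[ℂ] H} (hJ : Function.Involutive J) {α q : ℝ}
    (hα : α ∈ Set.Ioo (-1 : ℝ) 1) (hq : q ∈ Set.Ioo (-1 : ℝ) 1) {x : H}
    {T T' : Module.End ℂ (Fock H)} (hT : IsCreationAdjoint J α q x T)
    (hT' : IsCreationAdjoint J α q x T') : T = T' :=
  LinearMap.ext fun g => eq_of_forall_fockInner_eq hJ hα hq fun f => by rw [← hT, ← hT']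

end Nondegenerate

/-! ### The annihilation operator -/

section CosetDecomposition

variable {n : ℕ}

/-- The permutation that sends `k` to the last position and is given by `p` elsewhere. These
permutations represent the decomposition of the symmetric group on `n + 1` letters into cosets of
the stabilizer of the last one. -/
def insertPerm (k : Fin (n + 1)) (p : Equiv.Perm (Fin n)) : Equiv.Perm (Fin (n + 1)) :=
  (finSuccEquiv' k).trans ((Equiv.optionCongr p).trans (finSuccEquiv' (Fin.last n)).symm)

@[simp] theorem insertPerm_self (k : Fin (n + 1)) (p : Equiv.Perm (Fin n)) :
    insertPerm k p k = Fin.last n := by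
  simp [insertPerm]

@[simp] theorem insertPerm_succAbove (k : Fin (n + 1)) (p : Equiv.Perm (Fin n)) (i : Fin n) :
    insertPerm k p (k.succAbove i) = (p i).castSucc := by
  simp [insertPerm]

theorem insertPerm_injective2 : Function.Injective2 (insertPerm (n := n)) := by
  intro k l p r h
  obtain rfl : k = l := (insertPerm k p).injective (by rw [insertPerm_self, h, insertPerm_self])
  refine ⟨rfl, Equiv.ext fun i => ?_⟩
  simpa using Equiv.congr_fun h (k.succAbove i)

theorem sum_perm_succ {M : Type*} [AddCommMonoid M] (F : Equiv.Perm (Fin (n + 1)) → M) :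
    ∑ p, F p = ∑ k, ∑ p, F (insertPerm k p) := by
  have h_bij : Function.Bijective (Function.uncurry (insertPerm (n := n))) := by
    rw [Fintype.bijective_iff_injective_and_card]
    refine ⟨insertPerm_injective2.uncurry, ?_⟩
    simp only [Fintype.card_prod, Fintype.card_fin, Fintype.card_perm, Nat.factorial_succ]
  rw [← Fintype.sum_prod_type']
  exact (h_bij.sum_comp F).symm

theorem sum_sign_succ {M : Type*} [AddCommMonoid M] (k : Fin (n + 1))
    (F : (Fin (n + 1) → ℤˣ) → M) :
    ∑ s, F s = ∑ s : Fin n → ℤˣ, ∑ t, F (k.insertNth t s) := by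
  rw [Finset.sum_comm, ← Fintype.sum_prod_type', ← Equiv.sum_comp (Fin.insertNthEquiv _ k)]
  rfl

theorem negCount_insertNth (k : Fin (n + 1)) (t : ℤˣ) (s : Fin n → ℤˣ) :
    negCount (k.insertNth t s : Fin (n + 1) → ℤˣ) = (if t = -1 then 1 else 0) + negCount s := by
  simp only [negCount, Finset.card_filter, Fin.sum_univ_succAbove _ k, Fin.insertNth_apply_same,
    Fin.insertNth_apply_succAbove]

theorem sum_lt_succAbove (k : Fin (n + 1)) :
    ∑ i : Fin n, (if k < k.succAbove i then 1 else 0) = n - k.val := by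
  have h := Fin.sum_univ_succAbove (fun i => if k < i then 1 else 0) k
  rw [← Finset.card_filter, Finset.filter_lt_eq_Ioi, Fin.card_Ioi] at h
  simpa using h.symm

theorem sum_succAbove_lt (k : Fin (n + 1)) :
    ∑ i : Fin n, (if k.succAbove i < k then 1 else 0) = k.val := by
  have h := Fin.sum_univ_succAbove (fun i => if i < k then 1 else 0) k
  rw [← Finset.card_filter, Finset.filter_gt_eq_Iio, Fin.card_Iio] at h
  simpa using h.symm

theorem pairInv_insertPerm (k : Fin (n + 1)) (p : Equiv.Perm (Fin n)) (t : ℤˣ)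
    (s : Fin n → ℤˣ) :
    pairInv (insertPerm k p) (k.insertNth t s) =
      (if t = -1 then n + k.val else n - k.val) + pairInv p s := by
  have h_right : ∀ i, pairTerm (insertPerm k p) (k.insertNth t s) (k, k.succAbove i) =
      if k < k.succAbove i then 1 else 0 := by
    intro i; simp [pairTerm, Fin.castSucc_lt_last]
  have h_left : ∀ i, pairTerm (insertPerm k p) (k.insertNth t s) (k.succAbove i, k) =
      (if t = -1 then 2 else 0) * if k.succAbove i < k then 1 else 0 := by
    intro i; simp [pairTerm, (Fin.castSucc_lt_last _).not_gt]
  have h_rest : ∀ i j, pairTerm (insertPerm k p) (k.insertNth t s)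
      (k.succAbove i, k.succAbove j) = pairTerm p s (i, j) := by
    intro i j; simp [pairTerm]
  have h_diag : pairTerm (insertPerm k p) (k.insertNth t s) (k, k) = 0 := by simp [pairTerm]
  simp only [pairInv, Fintype.sum_prod_type, Fin.sum_univ_succAbove _ k, Finset.sum_add_distrib,
    h_right, h_left, h_rest, h_diag, ← Finset.mul_sum, sum_lt_succAbove, sum_succAbove_lt]
  have := k.isLt
  split_ifs <;> omega

end CosetDecomposition

section Annihilation

variable {H : Type*} [NormedAddCommGroup H] [InnerProductSpace ℂ H]

theorem tensorInner_symmetrizer_tprod (J : H →ₗ[ℂ] H) (α q : ℝ) {n : ℕ} (y v : Fin n → H) :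
    tensorInner n (PiTensorProduct.tprod ℂ y) (symmetrizer J α q n (PiTensorProduct.tprod ℂ v)) =
      ∑ p, ∑ s, (α : ℂ) ^ negCount s * (q : ℂ) ^ pairInv p s *
        ∏ i, ⟪y (p i), signMap J (s i) (v i)⟫_ℂ := by
  rw [← Fintype.sum_prod_type', symmetrizer, LinearMap.sum_apply, map_sum]
  refine Fintype.sum_equiv (signedPermEquiv n) _ _ fun σ => ?_
  rw [LinearMap.smul_apply, map_smul, groupAction_tprod_eq_signMap, tensorInner_tprod, smul_eq_mul,
    length₁_eq_negCount, length₂_eq_pairInv, ← Equiv.prod_comp (absPerm σ)]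
  simp only [Equiv.symm_apply_apply]
  rfl

/-- The linear form by which the annihilation operator contracts the factor `k` of a tensor of
degree `n + 1`, where `k` counts from `0`. -/
def contractionForm (J : H →ₗ[ℂ] H) (α q : ℝ) (x : H) (n k : ℕ) : H →ₗ[ℂ] ℂ :=
  (q : ℂ) ^ (n - k) • innerₛₗ ℂ x + ((α : ℂ) * (q : ℂ) ^ (n + k)) • (innerₛₗ ℂ x ∘ₗ J)

theorem contractionForm_apply (J : H →ₗ[ℂ] H) (α q : ℝ) (x : H) (n k : ℕ) (z : H) :
    contractionForm J α q x n k z =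
      (q : ℂ) ^ (n - k) * ⟪x, z⟫_ℂ + (α : ℂ) * (q : ℂ) ^ (n + k) * ⟪x, J z⟫_ℂ := by
  simp [contractionForm]

/-- The linear map `x₁ ⊗ ⋯ ⊗ x_{n+1} ↦ ∑_k c_k(x_k) x₁ ⊗ ⋯ ⊗ x_{k-1} ⊗ x_{k+1} ⊗ ⋯ ⊗ x_{n+1}` by
which the annihilation operator acts in degree `n + 1`, with `c_k` the contraction form. -/
def contractTensor (J : H →ₗ[ℂ] H) (α q : ℝ) (x : H) (n : ℕ) :
    (⨂[ℂ]^(n + 1) H) →ₗ[ℂ] (⨂[ℂ]^n H) :=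
  PiTensorProduct.lift (∑ k : Fin (n + 1), LinearMap.uncurryMid (M := fun _ => H) k
    ((contractionForm J α q x n k).smulRight (PiTensorProduct.tprod ℂ)))

theorem contractTensor_tprod (J : H →ₗ[ℂ] H) (α q : ℝ) (x : H) (n : ℕ) (v : Fin (n + 1) → H) :
    contractTensor J α q x n (PiTensorProduct.tprod ℂ v) =
      ∑ k : Fin (n + 1), contractionForm J α q x n k (v k) •
        PiTensorProduct.tprod ℂ (fun i => v (k.succAbove i)) := by
  rw [contractTensor, PiTensorProduct.lift.tprod, sum_apply]
  rfl

theorem appendTensor_tprod (x : H) (n : ℕ) (v : Fin n → H) :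
    appendTensor x n (PiTensorProduct.tprod ℂ v) =
      PiTensorProduct.tprod ℂ (Fin.snoc v x : Fin (n + 1) → H) := by
  simp [appendTensor]

theorem tensorInner_appendTensor_tprod (J : H →ₗ[ℂ] H) (α q : ℝ) (x : H) {n : ℕ}
    (y : Fin n → H) (v : Fin (n + 1) → H) :
    tensorInner (n + 1) (appendTensor x n (PiTensorProduct.tprod ℂ y))
        (symmetrizer J α q (n + 1) (PiTensorProduct.tprod ℂ v)) =
      tensorInner n (PiTensorProduct.tprod ℂ y)
        (symmetrizer J α q n (contractTensor J α q x n (PiTensorProduct.tprod ℂ v))) := by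
  rw [appendTensor_tprod, tensorInner_symmetrizer_tprod, sum_perm_succ, contractTensor_tprod,
    map_sum, map_sum]
  refine Finset.sum_congr rfl fun k _ => ?_
  rw [map_smul, map_smul, tensorInner_symmetrizer_tprod, smul_eq_mul, Finset.mul_sum]
  refine Finset.sum_congr rfl fun p _ => ?_
  rw [sum_sign_succ k, Finset.mul_sum]
  refine Finset.sum_congr rfl fun s _ => ?_
  have h_ne : (1 : ℤˣ) ≠ -1 := by decide
  rw [sum_units, contractionForm_apply]
  simp only [negCount_insertNth, pairInv_insertPerm, Fin.prod_univ_succAbove _ k, insertPerm_self,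
    Fin.insertNth_apply_same, Fin.insertNth_apply_succAbove, insertPerm_succAbove, Fin.snoc_last,
    Fin.snoc_castSucc, h_ne, if_true, if_false, signMap_one, signMap_neg_one, LinearMap.id_apply,
    pow_add]
  ring

theorem tensorInner_appendTensor (J : H →ₗ[ℂ] H) (α q : ℝ) (x : H) {n : ℕ}
    (u : ⨂[ℂ]^n H) (w : ⨂[ℂ]^(n + 1) H) :
    tensorInner (n + 1) (appendTensor x n u) (symmetrizer J α q (n + 1) w) =
      tensorInner n u (symmetrizer J α q n (contractTensor J α q x n w)) := by
  induction u using PiTensorProduct.induction_on with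
  | smul_tprod r y =>
    simp only [map_smul, map_smulₛₗ, LinearMap.smul_apply]
    congr 1
    induction w using PiTensorProduct.induction_on with
    | smul_tprod r v => simp only [map_smul, tensorInner_appendTensor_tprod]
    | add a b ha hb => simp only [map_add, ha, hb]
  | add a b ha hb => simp only [map_add, LinearMap.add_apply, ha, hb]

/-- The closed form of the annihilation operator. -/
def contraction (J : H →ₗ[ℂ] H) (α q : ℝ) (x : H) : Module.End ℂ (Fock H) :=
  DirectSum.toModule ℂ ℕ (Fock H) fun n => match n with
    | 0 => 0
    | n + 1 => DirectSum.lof ℂ ℕ (fun n => ⨂[ℂ]^n H) n ∘ₗ contractTensor J α q x n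

theorem contraction_lof_succ (J : H →ₗ[ℂ] H) (α q : ℝ) (x : H) (n : ℕ) (u : ⨂[ℂ]^(n + 1) H) :
    contraction J α q x (DirectSum.lof ℂ ℕ (fun n => ⨂[ℂ]^n H) (n + 1) u) =
      DirectSum.lof ℂ ℕ (fun n => ⨂[ℂ]^n H) n (contractTensor J α q x n u) := by
  rw [contraction, DirectSum.toModule_lof]
  rfl

theorem contraction_lof_zero (J : H →ₗ[ℂ] H) (α q : ℝ) (x : H) (u : ⨂[ℂ]^0 H) :
    contraction J α q x (DirectSum.lof ℂ ℕ (fun n => ⨂[ℂ]^n H) 0 u) = 0 := by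
  rw [contraction, DirectSum.toModule_lof]
  rfl

theorem contraction_apply (J : H →ₗ[ℂ] H) (α q : ℝ) (x : H) (g : Fock H) (n : ℕ) :
    contraction J α q x g n = contractTensor J α q x n (g (n + 1)) := by
  induction g using DirectSum.induction_on with
  | zero => simp
  | of m y =>
    rw [← DirectSum.lof_eq_of ℂ]
    cases m with
    | zero =>
      rw [contraction_lof_zero, DirectSum.lof_eq_of,
        DirectSum.of_eq_of_ne _ _ _ (Nat.succ_ne_zero n)]
      simp
    | succ m =>
      rw [contraction_lof_succ]
      rcases eq_or_ne n m with rfl | h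
      · simp [DirectSum.lof_apply]
      · rw [DirectSum.lof_eq_of, DirectSum.lof_eq_of, DirectSum.of_eq_of_ne _ _ _ h,
          DirectSum.of_eq_of_ne _ _ _ (Nat.succ_injective.ne h), map_zero]
  | add a b ha hb => rw [map_add, DirectSum.add_apply, DirectSum.add_apply, ha, hb, map_add]

theorem isCreationAdjoint_contraction (J : H →ₗ[ℂ] H) (α q : ℝ) (x : H) :
    IsCreationAdjoint J α q x (contraction J α q x) := by
  intro f g
  induction f using DirectSum.induction_on with
  | zero => rw [map_zero, fockInner_zero_left, fockInner_zero_left]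
  | of n u =>
    rw [← DirectSum.lof_eq_of ℂ, fockInner_lof, contraction_apply, creation,
      DirectSum.toModule_lof, LinearMap.comp_apply, fockInner_lof, tensorInner_appendTensor]
  | add a b ha hb => rw [map_add, fockInner_add_left, fockInner_add_left, ha, hb]

theorem annihilation_eq_contraction {J : H →ₗ[ℂ] H} (hJ : Function.Involutive J) {α q : ℝ}
    (hα : α ∈ Set.Ioo (-1 : ℝ) 1) (hq : q ∈ Set.Ioo (-1 : ℝ) 1) (x : H) :
    annihilation J α q x = contraction J α q x := by
  have h : ∃ T, IsCreationAdjoint J α q x T := ⟨_, isCreationAdjoint_contraction J α q x⟩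
  rw [annihilation, dif_pos h]
  exact h.choose_spec.unique hJ hα hq (isCreationAdjoint_contraction J α q x)

theorem isCreationAdjoint_iff {J : H →ₗ[ℂ] H} (hJ : Function.Involutive J) {α q : ℝ}
    (hα : α ∈ Set.Ioo (-1 : ℝ) 1) (hq : q ∈ Set.Ioo (-1 : ℝ) 1) (x : H)
    (T : Module.End ℂ (Fock H)) :
    IsCreationAdjoint J α q x T ↔ T = annihilation J α q x := by
  rw [annihilation_eq_contraction hJ hα hq]
  constructor
  · exact fun h => h.unique hJ hα hq (isCreationAdjoint_contraction J α q x)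
  · rintro rfl
    exact isCreationAdjoint_contraction J α q x

end Annihilation

/-! ### Diagrams -/

section Diagrams

/-- The points of `{0, …, n - 1}` that belong to no pair of `P`. -/
def openPoints (n : ℕ) (P : Finset (ℕ × ℕ)) : Finset ℕ :=
  {i ∈ Finset.range n | ∀ v ∈ P, i ≠ v.1 ∧ i ≠ v.2}

theorem mem_openPoints {n : ℕ} {P : Finset (ℕ × ℕ)} {i : ℕ} :
    i ∈ openPoints n P ↔ i < n ∧ ∀ v ∈ P, i ≠ v.1 ∧ i ≠ v.2 := by
  simp [openPoints]

/-- `P` is the set of the pairs `(a, b)`, `a < b`, of a partition of `{0, …, n - 1}` into pairs and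
singletons that is compatible with `ε`. Recording only the pairs, as natural numbers, lets a diagram
on `n` points be viewed as one on `n + 1` points. -/
structure IsDiagram (ε : ℕ → Exponent) (n : ℕ) (P : Finset (ℕ × ℕ)) : Prop where
  fst_lt_snd : ∀ v ∈ P, v.1 < v.2
  snd_lt : ∀ v ∈ P, v.2 < n
  star_fst : ∀ v ∈ P, ε v.1 = .star
  one_snd : ∀ v ∈ P, ε v.2 = .one
  injOn_fst : Set.InjOn Prod.fst (P : Set (ℕ × ℕ))
  injOn_snd : Set.InjOn Prod.snd (P : Set (ℕ × ℕ))
  exists_snd_eq : ∀ i < n, ε i = .one → ∃ v ∈ P, v.2 = i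

open Classical in
/-- The finite set of all diagrams. -/
def diagrams (ε : ℕ → Exponent) (n : ℕ) : Finset (Finset (ℕ × ℕ)) :=
  (Finset.range n ×ˢ Finset.range n).powerset.filter (IsDiagram ε n)

variable {ε : ℕ → Exponent} {n k : ℕ} {P : Finset (ℕ × ℕ)}

theorem mem_diagrams : P ∈ diagrams ε n ↔ IsDiagram ε n P := by
  simp only [diagrams, Finset.mem_filter, Finset.mem_powerset, and_iff_right_iff_imp]
  intro hP v hv
  have h_lt := hP.fst_lt_snd v hv
  have h_snd := hP.snd_lt v hv
  simp only [Finset.mem_product, Finset.mem_range]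
  omega

theorem diagrams_zero : diagrams ε 0 = {∅} := by
  ext P
  rw [mem_diagrams, Finset.mem_singleton]
  constructor
  · exact fun hP => Finset.eq_empty_of_forall_notMem fun v hv =>
      absurd (hP.snd_lt v hv) (Nat.not_lt_zero _)
  · rintro rfl
    constructor <;> simp

theorem diagrams_succ_of_star (hε : ε n = .star) : diagrams ε (n + 1) = diagrams ε n := by
  ext P
  rw [mem_diagrams, mem_diagrams]
  constructor
  · intro hP
    refine { hP with
      snd_lt := fun v hv => lt_of_le_of_ne (Nat.lt_succ_iff.1 (hP.snd_lt v hv)) fun h_eq => ?_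
      exists_snd_eq := fun i hi => hP.exists_snd_eq i (hi.trans n.lt_succ_self) }
    simpa [h_eq, hε] using hP.one_snd v hv
  · intro hP
    refine { hP with
      snd_lt := fun v hv => (hP.snd_lt v hv).trans n.lt_succ_self
      exists_snd_eq := fun i hi h_one => ?_ }
    rcases Nat.lt_succ_iff_lt_or_eq.1 hi with hi | rfl
    · exact hP.exists_snd_eq i hi h_one
    · simp [hε] at h_one

namespace IsDiagram

theorem notMem (hP : IsDiagram ε n P) (k : ℕ) : (k, n) ∉ P :=
  fun h => lt_irrefl _ (hP.snd_lt _ h)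

theorem star_of_mem_openPoints (hP : IsDiagram ε n P) (hk : k ∈ openPoints n P) :
    ε k = .star := by
  rw [mem_openPoints] at hk
  cases hε : ε k with
  | star => rfl
  | one =>
    obtain ⟨v, hv, rfl⟩ := hP.exists_snd_eq k hk.1 hε
    exact absurd rfl (hk.2 v hv).2

theorem insert (hP : IsDiagram ε n P) (hε : ε n = .one) (hk : k ∈ openPoints n P) :
    IsDiagram ε (n + 1) (insert (k, n) P) where
  fst_lt_snd := Finset.forall_mem_insert _ _ _ |>.2 ⟨(mem_openPoints.1 hk).1, hP.fst_lt_snd⟩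
  snd_lt := Finset.forall_mem_insert _ _ _ |>.2
    ⟨n.lt_succ_self, fun v hv => (hP.snd_lt v hv).trans n.lt_succ_self⟩
  star_fst := Finset.forall_mem_insert _ _ _ |>.2 ⟨hP.star_of_mem_openPoints hk, hP.star_fst⟩
  one_snd := Finset.forall_mem_insert _ _ _ |>.2 ⟨hε, hP.one_snd⟩
  injOn_fst := by
    rw [Finset.coe_insert, Set.injOn_insert (hP.notMem k)]
    refine ⟨hP.injOn_fst, ?_⟩
    rintro ⟨v, hv, h_eq⟩
    exact ((mem_openPoints.1 hk).2 v hv).1 h_eq.symm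
  injOn_snd := by
    rw [Finset.coe_insert, Set.injOn_insert (hP.notMem k)]
    refine ⟨hP.injOn_snd, ?_⟩
    rintro ⟨v, hv, h_eq⟩
    exact (hP.snd_lt v hv).ne h_eq
  exists_snd_eq i hi h_one := by
    rcases Nat.lt_succ_iff_lt_or_eq.1 hi with hi | rfl
    · obtain ⟨v, hv, hvi⟩ := hP.exists_snd_eq i hi h_one
      exact ⟨v, Finset.mem_insert_of_mem hv, hvi⟩
    · exact ⟨(k, i), Finset.mem_insert_self _ _, rfl⟩

theorem erase (hP : IsDiagram ε (n + 1) P) (hk : (k, n) ∈ P) :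
    IsDiagram ε n (P.erase (k, n)) where
  fst_lt_snd v hv := hP.fst_lt_snd v (Finset.mem_of_mem_erase hv)
  snd_lt v hv := by
    refine lt_of_le_of_ne (Nat.lt_succ_iff.1 (hP.snd_lt v (Finset.mem_of_mem_erase hv))) fun h => ?_
    exact Finset.ne_of_mem_erase hv (hP.injOn_snd (Finset.mem_of_mem_erase hv) hk h)
  star_fst v hv := hP.star_fst v (Finset.mem_of_mem_erase hv)
  one_snd v hv := hP.one_snd v (Finset.mem_of_mem_erase hv)
  injOn_fst := hP.injOn_fst.mono (Finset.coe_subset.2 (Finset.erase_subset _ _))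
  injOn_snd := hP.injOn_snd.mono (Finset.coe_subset.2 (Finset.erase_subset _ _))
  exists_snd_eq i hi h_one := by
    obtain ⟨v, hv, rfl⟩ := hP.exists_snd_eq i (hi.trans n.lt_succ_self) h_one
    exact ⟨v, Finset.mem_erase.2 ⟨by rintro rfl; exact lt_irrefl _ hi, hv⟩, rfl⟩

theorem mem_openPoints_erase (hP : IsDiagram ε (n + 1) P) (hk : (k, n) ∈ P) :
    k ∈ openPoints n (P.erase (k, n)) := by
  refine mem_openPoints.2 ⟨hP.fst_lt_snd _ hk, fun v hv => ⟨fun h => ?_, fun h => ?_⟩⟩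
  · exact Finset.ne_of_mem_erase hv (hP.injOn_fst (Finset.mem_of_mem_erase hv) hk h.symm)
  · have h_star := hP.star_fst _ hk
    have h_one := hP.one_snd v (Finset.mem_of_mem_erase hv)
    simp [← h, h_star] at h_one

end IsDiagram

theorem sum_diagrams_succ_of_one {M : Type*} [AddCommMonoid M] (hε : ε n = .one)
    (F : Finset (ℕ × ℕ) → M) :
    ∑ P ∈ diagrams ε (n + 1), F P =
      ∑ P ∈ diagrams ε n, ∑ k ∈ openPoints n P, F (insert (k, n) P) := by
  rw [Finset.sum_sigma']
  symm
  refine Finset.sum_bij (fun a _ => insert (a.2, n) a.1) ?_ ?_ ?_ fun _ _ => rfl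
  · rintro ⟨P, k⟩ h
    rw [Finset.mem_sigma, mem_diagrams] at h
    exact mem_diagrams.2 (h.1.insert hε h.2)
  · rintro ⟨P, k⟩ hP ⟨Q, l⟩ hQ h_eq
    replace hP : IsDiagram ε n P := mem_diagrams.1 (Finset.mem_sigma.1 hP).1
    replace hQ : IsDiagram ε n Q := mem_diagrams.1 (Finset.mem_sigma.1 hQ).1
    replace h_eq : insert (k, n) P = insert (l, n) Q := h_eq
    obtain rfl : k = l := by
      rcases Finset.mem_insert.1 (h_eq ▸ Finset.mem_insert_self (k, n) P) with h | h
      · exact congrArg Prod.fst h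
      · exact absurd h (hQ.notMem k)
    rw [← Finset.erase_insert (hP.notMem k), h_eq, Finset.erase_insert (hQ.notMem k)]
  · intro Q hQ
    rw [mem_diagrams] at hQ
    obtain ⟨⟨k, _⟩, hv, rfl⟩ := hQ.exists_snd_eq n n.lt_succ_self hε
    exact ⟨⟨_, k⟩, Finset.mem_sigma.2 ⟨mem_diagrams.2 (hQ.erase hv), hQ.mem_openPoints_erase hv⟩,
      Finset.insert_erase hv⟩

/-- The number of crossings of a diagram. -/
def diagramCrossings (P : Finset (ℕ × ℕ)) : ℕ :=
  ∑ v ∈ P, ∑ w ∈ P, if v.1 < w.1 ∧ w.1 < v.2 ∧ v.2 < w.2 then 1 else 0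

/-- The number of open points that lie under the pair `w`, summed over the pairs `w`. -/
def diagramInner (n : ℕ) (P : Finset (ℕ × ℕ)) : ℕ :=
  ∑ c ∈ openPoints n P, ∑ w ∈ P, if w.1 < c ∧ c < w.2 then 1 else 0

/-- The number of pairs that cover `v`. -/
def diagramCover (P : Finset (ℕ × ℕ)) (v : ℕ × ℕ) : ℕ :=
  ∑ w ∈ P, if w.1 < v.1 ∧ v.2 < w.2 then 1 else 0

/-- The number of open points to the left of `v`. -/
def diagramLeft (n : ℕ) (P : Finset (ℕ × ℕ)) (v : ℕ × ℕ) : ℕ :=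
  ∑ c ∈ openPoints n P, if c < v.1 then 1 else 0

theorem notMem_openPoints (n : ℕ) (P : Finset (ℕ × ℕ)) : n ∉ openPoints n P :=
  fun h => lt_irrefl _ (mem_openPoints.1 h).1

theorem openPoints_succ (hP : IsDiagram ε n P) :
    openPoints (n + 1) P = insert n (openPoints n P) := by
  have h_open : ∀ v ∈ P, n ≠ v.1 ∧ n ≠ v.2 := fun v hv =>
    ⟨((hP.fst_lt_snd v hv).trans (hP.snd_lt v hv)).ne', (hP.snd_lt v hv).ne'⟩
  rw [openPoints, Finset.range_add_one, Finset.filter_insert, if_pos h_open, openPoints]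

theorem openPoints_insert (n k : ℕ) (P : Finset (ℕ × ℕ)) :
    openPoints (n + 1) (insert (k, n) P) = (openPoints n P).erase k := by
  ext i
  rw [Finset.mem_erase, mem_openPoints, mem_openPoints, Finset.forall_mem_insert]
  constructor
  · rintro ⟨h_lt, ⟨h_ne, h_ne'⟩, h_open⟩
    exact ⟨h_ne, lt_of_le_of_ne (Nat.lt_succ_iff.1 h_lt) h_ne', h_open⟩
  · rintro ⟨h_ne, h_lt, h_open⟩
    exact ⟨h_lt.trans n.lt_succ_self, ⟨h_ne, h_lt.ne⟩, h_open⟩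

theorem diagramInner_succ (hP : IsDiagram ε n P) : diagramInner (n + 1) P = diagramInner n P := by
  rw [diagramInner, openPoints_succ hP, Finset.sum_insert (notMem_openPoints n P),
    Finset.sum_eq_zero, zero_add, diagramInner]
  intro w hw
  have h_snd := hP.snd_lt w hw
  rw [if_neg (by omega)]

theorem diagramLeft_succ (hP : IsDiagram ε n P) {v : ℕ × ℕ} (hv : v ∈ P) :
    diagramLeft (n + 1) P v = diagramLeft n P v := by
  have h_lt := hP.fst_lt_snd v hv
  have h_snd := hP.snd_lt v hv
  rw [diagramLeft, openPoints_succ hP, Finset.sum_insert (notMem_openPoints n P),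
    if_neg (by omega), zero_add, diagramLeft]

theorem diagramCrossings_insert (hP : IsDiagram ε n P) (k : ℕ) :
    diagramCrossings (insert (k, n) P) =
      diagramCrossings P + ∑ v ∈ P, if v.1 < k ∧ k < v.2 then 1 else 0 := by
  have h_new : ∀ w ∈ insert (k, n) P, ¬(k < w.1 ∧ w.1 < n ∧ n < w.2) := by
    refine Finset.forall_mem_insert _ _ _ |>.2 ⟨by simp, fun w hw h => ?_⟩
    exact (hP.snd_lt w hw).not_gt h.2.2
  rw [diagramCrossings, Finset.sum_insert (hP.notMem k),
    Finset.sum_eq_zero fun w hw => if_neg (h_new w hw), zero_add, diagramCrossings, add_comm,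
    ← Finset.sum_add_distrib]
  refine Finset.sum_congr rfl fun v hv => ?_
  simp [Finset.sum_insert (hP.notMem k), hP.snd_lt v hv]

theorem diagramInner_insert (hP : IsDiagram ε n P) (hk : k ∈ openPoints n P) :
    diagramInner (n + 1) (insert (k, n) P) + ∑ v ∈ P, (if v.1 < k ∧ k < v.2 then 1 else 0) =
      diagramInner n P + ((openPoints n P).filter (k < ·)).card := by
  have h_card : ((openPoints n P).filter (k < ·)).card =
      ∑ c ∈ (openPoints n P).erase k, if k < c ∧ c < n then 1 else 0 := by
    rw [Finset.card_filter, ← Finset.add_sum_erase _ _ hk, if_neg (lt_irrefl k), zero_add]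
    refine Finset.sum_congr rfl fun c hc => ?_
    simp [(mem_openPoints.1 (Finset.mem_of_mem_erase hc)).1]
  rw [h_card, diagramInner, diagramInner, openPoints_insert,
    ← Finset.add_sum_erase (openPoints n P) _ hk]
  simp only [Finset.sum_insert (hP.notMem k), Finset.sum_add_distrib]
  ring

theorem diagramCover_insert (hP : IsDiagram ε n P) (k : ℕ) {v : ℕ × ℕ} (hv : v ∈ P) :
    diagramCover (insert (k, n) P) v = diagramCover P v + if k < v.1 then 1 else 0 := by
  rw [diagramCover, Finset.sum_insert (hP.notMem k), add_comm, diagramCover]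
  simp [hP.snd_lt v hv]

theorem diagramLeft_insert (hk : k ∈ openPoints n P) (v : ℕ × ℕ) :
    diagramLeft (n + 1) (insert (k, n) P) v + (if k < v.1 then 1 else 0) = diagramLeft n P v := by
  rw [diagramLeft, openPoints_insert, Finset.sum_erase_add _ _ hk, diagramLeft]

theorem diagramCover_insert_self (hP : IsDiagram ε n P) (k : ℕ) :
    diagramCover (insert (k, n) P) (k, n) = 0 := by
  refine Finset.sum_eq_zero fun w hw => if_neg fun h => ?_
  rcases Finset.mem_insert.1 hw with rfl | hw
  · exact lt_irrefl _ h.1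
  · exact (hP.snd_lt w hw).not_gt h.2

theorem diagramLeft_insert_self (hk : k ∈ openPoints n P) :
    diagramLeft (n + 1) (insert (k, n) P) (k, n) = ((openPoints n P).filter (· < k)).card := by
  have h := diagramLeft_insert hk (k, n)
  rw [if_neg (lt_irrefl k), add_zero] at h
  rw [h, diagramLeft, Finset.card_filter]

end Diagrams

/-! ### Ordered tensor products -/

section OrderedTensor

variable {H ι κ : Type*} [NormedAddCommGroup H] [InnerProductSpace ℂ H] [LinearOrder ι]
  [LinearOrder κ]

theorem orderEmbOfFin_erase {S : Finset ι} {m : ℕ} (h : S.card = m + 1) (k : Fin (m + 1))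
    (h' : (S.erase (S.orderEmbOfFin h k)).card = m) (i : Fin m) :
    (S.erase (S.orderEmbOfFin h k)).orderEmbOfFin h' i = S.orderEmbOfFin h (k.succAbove i) := by
  have h_unique := Finset.orderEmbOfFin_unique h' (f := fun i => S.orderEmbOfFin h (k.succAbove i))
    (fun i => Finset.mem_erase.2 ⟨by simp, S.orderEmbOfFin_mem h _⟩)
    (fun i j hij => by simpa using hij)
  exact (congrFun h_unique i).symm

theorem sum_eq_sum_orderEmbOfFin {M : Type*} [AddCommMonoid M] {S : Finset ι} {m : ℕ}
    (h : S.card = m) (F : ι → M) : ∑ i ∈ S, F i = ∑ k, F (S.orderEmbOfFin h k) := by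
  conv_lhs => rw [← Finset.map_orderEmbOfFin_univ S h, Finset.sum_map]
  rfl

theorem card_filter_lt_orderEmbOfFin {S : Finset ι} {m : ℕ} (h : S.card = m) (k : Fin m) :
    (S.filter (· < S.orderEmbOfFin h k)).card = k := by
  rw [Finset.card_filter, sum_eq_sum_orderEmbOfFin h]
  simp [Finset.filter_gt_eq_Iio]

theorem card_filter_orderEmbOfFin_lt {S : Finset ι} {m : ℕ} (h : S.card = m) (k : Fin m) :
    (S.filter (S.orderEmbOfFin h k < ·)).card = m - 1 - k := by
  rw [Finset.card_filter, sum_eq_sum_orderEmbOfFin h]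
  simp [Finset.filter_lt_eq_Ioi]

/-- The tensor product of the `x i`, `i ∈ S`, in increasing order of the indices. It extends
`tensorOver` to arbitrary linearly ordered index types. -/
def orderedTensor (x : ι → H) (S : Finset ι) : Fock H :=
  pureTensor (fun k : Fin S.card => x (S.orderEmbOfFin rfl k))

theorem orderedTensor_eq (x : ι → H) {S : Finset ι} {m : ℕ} (h : S.card = m) :
    orderedTensor x S = pureTensor (fun k : Fin m => x (S.orderEmbOfFin h k)) := by
  subst h; rfl

theorem orderedTensor_empty (x : ι → H) : orderedTensor x ∅ = vacuum := by
  rw [orderedTensor_eq x Finset.card_empty, vacuum]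
  congr 1
  exact Subsingleton.elim _ _

theorem orderedTensor_map (x : κ → H) (f : ι ↪o κ) (S : Finset ι) :
    orderedTensor x (S.map f.toEmbedding) = orderedTensor (fun i => x (f i)) S := by
  have h_card : (S.map f.toEmbedding).card = S.card := Finset.card_map _
  have h_unique := Finset.orderEmbOfFin_unique h_card (f := fun k => f (S.orderEmbOfFin rfl k))
    (fun k => Finset.mem_map_of_mem f.toEmbedding (S.orderEmbOfFin_mem rfl k))
    (f.strictMono.comp (S.orderEmbOfFin rfl).strictMono)
  rw [orderedTensor_eq x h_card, ← h_unique, orderedTensor]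

theorem creation_orderedTensor (x : ι → H) {S : Finset ι} {a : ι} (hS : ∀ i ∈ S, i < a) :
    creation (x a) (orderedTensor x S) = orderedTensor x (insert a S) := by
  have h_card : (insert a S).card = S.card + 1 :=
    Finset.card_insert_of_notMem fun h => lt_irrefl _ (hS a h)
  have h_mono : StrictMono (Fin.snoc (S.orderEmbOfFin rfl) a : Fin (S.card + 1) → ι) := by
    intro i j hij
    induction j using Fin.lastCases with
    | last =>
      induction i using Fin.lastCases with
      | last => exact absurd hij (lt_irrefl _)
      | cast i => simpa using hS _ (S.orderEmbOfFin_mem rfl i)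
    | cast j =>
      induction i using Fin.lastCases with
      | last => exact absurd hij (Fin.castSucc_lt_last j).not_gt
      | cast i => simpa using hij
  have h_mem : ∀ k, (Fin.snoc (S.orderEmbOfFin rfl) a : Fin (S.card + 1) → ι) k ∈ insert a S := by
    intro k
    induction k using Fin.lastCases with
    | last => simp
    | cast k => simp
  rw [orderedTensor_eq x h_card, ← Finset.orderEmbOfFin_unique h_card h_mem h_mono, orderedTensor,
    creation_pureTensor]
  congr 1
  ext1 k
  induction k using Fin.lastCases with
  | last => simp
  | cast k => simp

theorem contraction_orderedTensor (J : H →ₗ[ℂ] H) (α q : ℝ) (y : H) (x : ι → H) (S : Finset ι) :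
    contraction J α q y (orderedTensor x S) = ∑ c ∈ S,
      ((q : ℂ) ^ (S.filter (c < ·)).card * (⟪y, x c⟫_ℂ +
        (α : ℂ) * (q : ℂ) ^ (2 * (S.filter (· < c)).card) * ⟪y, J (x c)⟫_ℂ)) •
      orderedTensor x (S.erase c) := by
  rcases h : S.card with _ | m
  · rw [Finset.card_eq_zero.1 h, Finset.sum_empty, orderedTensor_empty, vacuum, pureTensor,
      contraction_lof_zero]
  · rw [orderedTensor_eq x h, pureTensor, contraction_lof_succ, contractTensor_tprod, map_sum,
      sum_eq_sum_orderEmbOfFin h]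
    refine Finset.sum_congr rfl fun k _ => ?_
    have h_erase : (S.erase (S.orderEmbOfFin h k)).card = m := by
      rw [Finset.card_erase_of_mem (S.orderEmbOfFin_mem h k), h, Nat.add_sub_cancel]
    have h_exponent : m + k.val = (m - k.val) + 2 * k.val := by omega
    rw [card_filter_lt_orderEmbOfFin, card_filter_orderEmbOfFin_lt, Nat.add_sub_cancel,
      orderedTensor_eq x h_erase, map_smul, contractionForm_apply, h_exponent, pow_add, pureTensor]
    simp only [orderEmbOfFin_erase]
    congr 1
    ring

end OrderedTensor

/-! ### The Wick formula as a sum over diagrams -/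

section DiagramFormula

variable {H : Type*} [NormedAddCommGroup H] [InnerProductSpace ℂ H]

theorem fockWord_succ (J : H →ₗ[ℂ] H) (α q : ℝ) {n : ℕ} (ε : Fin (n + 1) → Exponent)
    (x : Fin (n + 1) → H) : fockWord J α q ε x = fockOp J α q (ε (Fin.last n)) (x (Fin.last n)) *
      fockWord J α q (fun i => ε i.castSucc) (fun i => x i.castSucc) := by
  rw [fockWord, List.ofFn_succ', List.concat_eq_append, List.reverse_append, List.prod_append,
    List.reverse_singleton, List.prod_singleton]
  rfl

/-- The coefficient of the diagram `P` in the Wick formula. -/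
def diagramWeight (J : H →ₗ[ℂ] H) (α q : ℝ) (x : ℕ → H) (n : ℕ) (P : Finset (ℕ × ℕ)) : ℂ :=
  (q : ℂ) ^ (diagramCrossings P + diagramInner n P) *
    ∏ v ∈ P, (⟪x v.2, x v.1⟫_ℂ +
      (α : ℂ) * (q : ℂ) ^ (2 * diagramCover P v + 2 * diagramLeft n P v) * ⟪x v.2, J (x v.1)⟫_ℂ)

theorem diagramWeight_empty (J : H →ₗ[ℂ] H) (α q : ℝ) (x : ℕ → H) (n : ℕ) :
    diagramWeight J α q x n ∅ = 1 := by
  simp [diagramWeight, diagramCrossings, diagramInner]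

theorem diagramWeight_succ (J : H →ₗ[ℂ] H) (α q : ℝ) (x : ℕ → H) {ε : ℕ → Exponent} {n : ℕ}
    {P : Finset (ℕ × ℕ)} (hP : IsDiagram ε n P) :
    diagramWeight J α q x (n + 1) P = diagramWeight J α q x n P := by
  rw [diagramWeight, diagramInner_succ hP, Finset.prod_congr rfl fun v hv => by
    rw [diagramLeft_succ hP hv], diagramWeight]

/- The new pair crosses the pairs that cover `k`, but these no longer cover `k` as an open point, so
the exponent of `q` grows only by the number of open points to the right of `k`. For an old pair to
the right of `k`, the new pair covers it in place of the open point `k` to its left. -/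
theorem diagramWeight_insert (J : H →ₗ[ℂ] H) (α q : ℝ) (x : ℕ → H) {ε : ℕ → Exponent} {n : ℕ}
    {P : Finset (ℕ × ℕ)} (hP : IsDiagram ε n P) {k : ℕ} (hk : k ∈ openPoints n P) :
    diagramWeight J α q x (n + 1) (insert (k, n) P) = diagramWeight J α q x n P *
      ((q : ℂ) ^ ((openPoints n P).filter (k < ·)).card * (⟪x n, x k⟫_ℂ +
        (α : ℂ) * (q : ℂ) ^ (2 * ((openPoints n P).filter (· < k)).card) * ⟪x n, J (x k)⟫_ℂ)) := by
  have h_exponent : diagramCrossings (insert (k, n) P) + diagramInner (n + 1) (insert (k, n) P) =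
      diagramCrossings P + diagramInner n P + ((openPoints n P).filter (k < ·)).card := by
    have h_inner := diagramInner_insert hP hk
    rw [diagramCrossings_insert hP k]
    omega
  have h_old : ∀ v ∈ P, 2 * diagramCover (insert (k, n) P) v +
      2 * diagramLeft (n + 1) (insert (k, n) P) v =
      2 * diagramCover P v + 2 * diagramLeft n P v := by
    intro v hv
    have h_left := diagramLeft_insert hk v
    rw [diagramCover_insert hP k hv]
    omega
  rw [diagramWeight, Finset.prod_insert (hP.notMem k), diagramCover_insert_self hP,
    diagramLeft_insert_self hk, h_exponent,
    Finset.prod_congr rfl fun v hv => by rw [h_old v hv], pow_add, diagramWeight]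
  simp only [mul_zero, zero_add]
  ring

theorem fockWord_vacuum_eq_sum_diagrams {J : H →ₗ[ℂ] H} (hJ : Function.Involutive J) {α q : ℝ}
    (hα : α ∈ Set.Ioo (-1 : ℝ) 1) (hq : q ∈ Set.Ioo (-1 : ℝ) 1) (x : ℕ → H) (ε : ℕ → Exponent)
    (n : ℕ) : fockWord J α q (fun i : Fin n => ε i) (fun i : Fin n => x i) vacuum =
      ∑ P ∈ diagrams ε n, diagramWeight J α q x n P • orderedTensor x (openPoints n P) := by
  induction n with
  | zero =>
    rw [diagrams_zero, Finset.sum_singleton, diagramWeight_empty, one_smul,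
      show openPoints 0 ∅ = ∅ from rfl, orderedTensor_empty]
    rfl
  | succ n ih =>
    rw [fockWord_succ, Module.End.mul_apply]
    simp only [Fin.val_castSucc, Fin.val_last]
    rw [ih, map_sum]
    cases hε : ε n with
    | star =>
      rw [diagrams_succ_of_star hε]
      refine Finset.sum_congr rfl fun P hP => ?_
      rw [mem_diagrams] at hP
      rw [map_smul, fockOp, creation_orderedTensor x fun i hi => (mem_openPoints.1 hi).1,
        diagramWeight_succ J α q x hP, openPoints_succ hP]
    | one =>
      rw [sum_diagrams_succ_of_one hε]
      refine Finset.sum_congr rfl fun P hP => ?_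
      rw [mem_diagrams] at hP
      rw [map_smul, fockOp, annihilation_eq_contraction hJ hα hq, contraction_orderedTensor,
        Finset.smul_sum]
      refine Finset.sum_congr rfl fun k hk => ?_
      rw [smul_smul, diagramWeight_insert J α q x hP hk, openPoints_insert]

end DiagramFormula

/-! ### Set partitions as diagrams -/

section Blocks

variable {n : ℕ} {π : SetPartition n} {V W : Block π} {i j : Fin n}

theorem lo_mem (V : Block π) : lo V ∈ V.1 := Finset.min'_mem _ _

theorem hi_mem (V : Block π) : hi V ∈ V.1 := Finset.max'_mem _ _

theorem lo_le (h : i ∈ V.1) : lo V ≤ i := Finset.min'_le _ _ h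

theorem le_hi (h : i ∈ V.1) : i ≤ hi V := Finset.le_max' _ _ h

theorem block_eq_of_mem (hV : i ∈ V.1) (hW : i ∈ W.1) : V = W :=
  Subtype.ext (π.eq_of_mem_parts V.2 W.2 hV hW)

theorem exists_mem_block (π : SetPartition n) (i : Fin n) : ∃ V : Block π, i ∈ V.1 := by
  obtain ⟨V, hV, hi⟩ := π.exists_mem (Finset.mem_univ i)
  exact ⟨⟨V, hV⟩, hi⟩

theorem lo_injective (π : SetPartition n) : Function.Injective (lo : Block π → Fin n) :=
  fun V W h => block_eq_of_mem (lo_mem V) (h ▸ lo_mem W)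

theorem hi_injective (π : SetPartition n) : Function.Injective (hi : Block π → Fin n) :=
  fun V W h => block_eq_of_mem (hi_mem V) (h ▸ hi_mem W)

theorem IsSingleton.eq (h : IsSingleton V) : V.1 = {lo V} := by
  obtain ⟨a, ha⟩ := Finset.card_eq_one.1 h
  have h_lo := lo_mem V
  rw [ha, Finset.mem_singleton] at h_lo
  rw [ha, h_lo]

theorem IsSingleton.hi_eq (h : IsSingleton V) : hi V = lo V := by
  simpa [h.eq] using hi_mem V

theorem IsPair.lo_lt_hi (h : IsPair V) : lo V < hi V :=
  Finset.min'_lt_max'_of_card _ (by rw [h]; exact one_lt_two)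

theorem IsPair.eq (h : IsPair V) : V.1 = {lo V, hi V} := by
  refine (Finset.eq_of_subset_of_card_le ?_ ?_).symm
  · simp [Finset.insert_subset_iff, lo_mem, hi_mem]
  · rw [h, Finset.card_pair h.lo_lt_hi.ne]

theorem IsPair.not_isSingleton (h : IsPair V) : ¬IsSingleton V := by
  unfold IsPair IsSingleton at *
  omega

theorem isPair_and_lo_hi_of_eq_pair (hij : i < j) (hV : V.1 = {i, j}) :
    IsPair V ∧ lo V = i ∧ hi V = j := by
  have h_lo := lo_mem V
  have h_hi := hi_mem V
  rw [hV, Finset.mem_insert, Finset.mem_singleton] at h_lo h_hi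
  refine ⟨by rw [IsPair, hV, Finset.card_pair hij.ne], h_lo.resolve_right fun h => ?_,
    h_hi.resolve_left fun h => ?_⟩
  · exact hij.not_ge (h ▸ lo_le (by simp [hV]))
  · exact hij.not_ge (h ▸ le_hi (by simp [hV]))

theorem leftOf_iff : LeftOf V W ↔ hi V < lo W :=
  ⟨fun h => h _ (hi_mem V) _ (lo_mem W), fun h _ hV _ hW =>
    (le_hi hV).trans_lt (h.trans_le (lo_le hW))⟩

theorem mem_pairs : V ∈ pairs π ↔ IsPair V := by
  simp [pairs]

open Classical in
/-- The singleton blocks, which `singletons` records by their elements. -/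
def singletonBlocks (π : SetPartition n) : Finset (Block π) := {V | IsSingleton V}

theorem mem_singletonBlocks : V ∈ singletonBlocks π ↔ IsSingleton V := by
  simp [singletonBlocks]

theorem mem_singletons : i ∈ singletons π ↔ {i} ∈ π.parts := by
  simp [singletons]

/-- The smallest element of a block, as a natural number. -/
def loNat (π : SetPartition n) : Block π ↪ ℕ :=
  ⟨fun V => lo V, Fin.val_injective.comp (lo_injective π)⟩

/-- The smallest and the largest element of a block, as natural numbers. -/
def endpoints (π : SetPartition n) : Block π ↪ ℕ × ℕ :=
  ⟨fun V => (lo V, hi V), fun _ _ h => (loNat π).injective (congrArg Prod.fst h)⟩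

/-- The diagram of a partition: the pairs of its pair blocks. -/
def diagram (π : SetPartition n) : Finset (ℕ × ℕ) := (pairs π).map (endpoints π)

theorem mem_diagram {v : ℕ × ℕ} :
    v ∈ diagram π ↔ ∃ V : Block π, IsPair V ∧ ((lo V : ℕ), (hi V : ℕ)) = v := by
  rw [diagram, Finset.mem_map]
  simp only [mem_pairs]
  rfl

theorem map_val_singletons (π : SetPartition n) :
    (singletons π).map Fin.valEmbedding = (singletonBlocks π).map (loNat π) := by
  ext i
  rw [Finset.mem_map, Finset.mem_map]
  constructor
  · rintro ⟨i, h_mem, rfl⟩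
    let V : Block π := ⟨{i}, mem_singletons.1 h_mem⟩
    exact ⟨V, mem_singletonBlocks.2 (Finset.card_singleton i),
      congrArg Fin.val (Finset.mem_singleton.1 (lo_mem V))⟩
  · rintro ⟨V, hV, rfl⟩
    exact ⟨lo V, mem_singletons.2 ((mem_singletonBlocks.1 hV).eq ▸ V.2), rfl⟩

end Blocks

section Compatible

variable {n : ℕ} {π : SetPartition n} {ε : Fin n → Exponent} {V W : Block π}

theorem mem_partitions : π ∈ partitions ε ↔ IsCompatible ε π := by
  simp [partitions]

namespace IsCompatible

theorem isPair_or_isSingleton (h : IsCompatible ε π) (V : Block π) : IsPair V ∨ IsSingleton V :=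
  (h V).imp And.left And.left

theorem star_lo (h : IsCompatible ε π) (V : Block π) : ε (lo V) = .star :=
  (h V).elim (fun h => h.2.1) And.right

theorem one_hi (h : IsCompatible ε π) (hV : IsPair V) : ε (hi V) = .one :=
  (h V).elim (fun h => h.2.2) fun hs => absurd hs.1 hV.not_isSingleton

theorem isPair_of_mem_of_lt (h : IsCompatible ε π) {i j : Fin n} (h_i : i ∈ V.1) (h_j : j ∈ V.1)
    (hij : i < j) : IsPair V ∧ i = lo V ∧ j = hi V := by
  have hV : IsPair V := by
    refine (h.isPair_or_isSingleton V).resolve_right fun hs => ?_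
    rw [hs.eq, Finset.mem_singleton] at h_i h_j
    exact hij.ne (h_i.trans h_j.symm)
  rw [hV.eq, Finset.mem_insert, Finset.mem_singleton] at h_i h_j
  have h_lt := hV.lo_lt_hi
  grind

theorem covers_iff (h : IsCompatible ε π) :
    Covers W V ↔ IsPair W ∧ lo W < lo V ∧ hi V < hi W := by
  constructor
  · rintro ⟨i, h_i, j, h_j, h_between⟩
    have h_lo := h_between _ (lo_mem V)
    obtain ⟨hW, rfl, rfl⟩ := h.isPair_of_mem_of_lt h_i h_j (h_lo.1.trans h_lo.2)
    exact ⟨hW, h_lo.1, (h_between _ (hi_mem V)).2⟩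
  · rintro ⟨-, h_lo, h_hi⟩
    exact ⟨lo W, lo_mem W, hi W, hi_mem W, fun k hk =>
      ⟨h_lo.trans_le (lo_le hk), (le_hi hk).trans_lt h_hi⟩⟩

theorem cross_iff (h : IsCompatible ε π) :
    (∃ i ∈ V.1, ∃ j ∈ V.1, ∃ k ∈ W.1, ∃ l ∈ W.1, i < k ∧ k < j ∧ j < l) ↔
      IsPair V ∧ IsPair W ∧ lo V < lo W ∧ lo W < hi V ∧ hi V < hi W := by
  constructor
  · rintro ⟨i, h_i, j, h_j, k, h_k, l, h_l, hik, hkj, hjl⟩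
    obtain ⟨hV, rfl, rfl⟩ := h.isPair_of_mem_of_lt h_i h_j (hik.trans hkj)
    obtain ⟨hW, rfl, rfl⟩ := h.isPair_of_mem_of_lt h_k h_l (hkj.trans hjl)
    exact ⟨hV, hW, hik, hkj, hjl⟩
  · rintro ⟨-, -, h_cross⟩
    exact ⟨lo V, lo_mem V, hi V, hi_mem V, lo W, lo_mem W, hi W, hi_mem W, h_cross⟩

theorem openPoints_diagram (h : IsCompatible ε π) :
    openPoints n (diagram π) = (singletonBlocks π).map (loNat π) := by
  ext i
  rw [mem_openPoints, Finset.mem_map]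
  constructor
  · rintro ⟨hi', h_open⟩
    obtain ⟨V, hV⟩ := exists_mem_block π ⟨i, hi'⟩
    have hs : IsSingleton V := by
      refine (h.isPair_or_isSingleton V).resolve_left fun hp => ?_
      obtain ⟨h_lo, h_hi⟩ := h_open _ (mem_diagram.2 ⟨V, hp, rfl⟩)
      rw [hp.eq, Finset.mem_insert, Finset.mem_singleton, Fin.ext_iff, Fin.ext_iff] at hV
      exact hV.elim h_lo h_hi
    rw [hs.eq, Finset.mem_singleton, Fin.ext_iff] at hV
    exact ⟨V, mem_singletonBlocks.2 hs, hV.symm⟩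
  · rintro ⟨V, hV, rfl⟩
    rw [mem_singletonBlocks] at hV
    refine ⟨(lo V).isLt, fun v hv => ?_⟩
    obtain ⟨W, hW, rfl⟩ := mem_diagram.1 hv
    have h_ne : V ≠ W := by
      rintro rfl
      exact hW.not_isSingleton hV
    exact ⟨fun h_eq => h_ne (lo_injective π (Fin.ext h_eq)), fun h_eq =>
      h_ne (block_eq_of_mem (lo_mem V) (Fin.ext h_eq ▸ hi_mem W))⟩

theorem isDiagram_diagram {ε : ℕ → Exponent} (h : IsCompatible (fun i : Fin n => ε i) π) :
    IsDiagram ε n (diagram π) where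
  fst_lt_snd v hv := by
    obtain ⟨V, hV, rfl⟩ := mem_diagram.1 hv
    exact hV.lo_lt_hi
  snd_lt v hv := by
    obtain ⟨V, -, rfl⟩ := mem_diagram.1 hv
    exact (hi V).isLt
  star_fst v hv := by
    obtain ⟨V, -, rfl⟩ := mem_diagram.1 hv
    exact h.star_lo V
  one_snd v hv := by
    obtain ⟨V, hV, rfl⟩ := mem_diagram.1 hv
    exact h.one_hi hV
  injOn_fst v hv w hw h_eq := by
    obtain ⟨V, -, rfl⟩ := mem_diagram.1 hv
    obtain ⟨W, -, rfl⟩ := mem_diagram.1 hw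
    rw [lo_injective π (Fin.ext h_eq)]
  injOn_snd v hv w hw h_eq := by
    obtain ⟨V, -, rfl⟩ := mem_diagram.1 hv
    obtain ⟨W, -, rfl⟩ := mem_diagram.1 hw
    rw [hi_injective π (Fin.ext h_eq)]
  exists_snd_eq i hi' h_one := by
    obtain ⟨V, hV⟩ := exists_mem_block π ⟨i, hi'⟩
    have h_ne : (⟨i, hi'⟩ : Fin n) ≠ lo V := fun h_eq => by
      have h_star : ε i = .star := (congrArg (fun i : Fin n => ε i) h_eq).trans (h.star_lo V)
      simp [h_star] at h_one
    obtain ⟨hp, -, h_hi⟩ :=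
      h.isPair_of_mem_of_lt (lo_mem V) hV (lt_of_le_of_ne (lo_le hV) h_ne.symm)
    exact ⟨_, mem_diagram.2 ⟨V, hp, rfl⟩, congrArg Fin.val h_hi.symm⟩

theorem parts_subset_of_diagram_eq {π' : SetPartition n} (h : IsCompatible ε π)
    (h' : IsCompatible ε π') (h_eq : diagram π = diagram π') : π.parts ⊆ π'.parts := by
  intro V hV
  suffices ∃ W : Block π', V = W.1 by
    obtain ⟨W, rfl⟩ := this
    exact W.2
  rcases h.isPair_or_isSingleton ⟨V, hV⟩ with hp | hs
  · obtain ⟨W, hW, hWV⟩ := mem_diagram.1 (h_eq ▸ mem_diagram.2 ⟨⟨V, hV⟩, hp, rfl⟩)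
    have h_lo : lo W = lo ⟨V, hV⟩ := Fin.ext (congrArg Prod.fst hWV)
    have h_hi : hi W = hi ⟨V, hV⟩ := Fin.ext (congrArg Prod.snd hWV)
    exact ⟨W, by rw [hW.eq, h_lo, h_hi]; exact hp.eq⟩
  · have h_open : (lo ⟨V, hV⟩ : ℕ) ∈ openPoints n (diagram π) := by
      rw [h.openPoints_diagram]
      exact Finset.mem_map_of_mem (loNat π) (mem_singletonBlocks.2 hs)
    rw [h_eq, h'.openPoints_diagram, Finset.mem_map] at h_open
    obtain ⟨W, hW, hWV⟩ := h_open
    have h_lo : lo W = lo ⟨V, hV⟩ := Fin.ext hWV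
    exact ⟨W, by rw [(mem_singletonBlocks.1 hW).eq, h_lo]; exact hs.eq⟩

end IsCompatible

theorem diagram_injOn (ε : Fin n → Exponent) :
    Set.InjOn diagram (partitions ε : Set (SetPartition n)) := by
  intro π hπ π' hπ' h_eq
  replace hπ := mem_partitions.1 hπ
  replace hπ' := mem_partitions.1 hπ'
  exact Finpartition.ext ((hπ.parts_subset_of_diagram_eq hπ' h_eq).antisymm
    (hπ'.parts_subset_of_diagram_eq hπ h_eq.symm))

end Compatible

section PartitionOfDiagram

variable {n : ℕ} {ε : ℕ → Exponent} {P : Finset (ℕ × ℕ)} {V W : Finset (Fin n)}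

theorem IsDiagram.eq_of_mem_endpoints (hP : IsDiagram ε n P) {v w : ℕ × ℕ} (hv : v ∈ P)
    (hw : w ∈ P) {i : ℕ} (hiv : i = v.1 ∨ i = v.2) (hiw : i = w.1 ∨ i = w.2) : v = w := by
  have h_ne : ∀ v ∈ P, ∀ w ∈ P, v.1 ≠ w.2 := fun v hv w hw h_eq => by
    have h_star := hP.star_fst v hv
    simp [h_eq, hP.one_snd w hw] at h_star
  rcases hiv with rfl | rfl <;> rcases hiw with h_eq | h_eq
  · exact hP.injOn_fst hv hw h_eq
  · exact absurd h_eq (h_ne v hv w hw)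
  · exact absurd h_eq.symm (h_ne w hw v hv)
  · exact hP.injOn_snd hv hw h_eq

/-- `V` is a block of the partition of `{0, …, n - 1}` with diagram `P`. -/
def IsDiagramBlock (P : Finset (ℕ × ℕ)) (V : Finset (Fin n)) : Prop :=
  (∃ i j : Fin n, (i.val, j.val) ∈ P ∧ V = {i, j}) ∨ ∃ i : Fin n, i.val ∈ openPoints n P ∧ V = {i}

theorem IsDiagram.exists_isDiagramBlock (hP : IsDiagram ε n P) (i : Fin n) :
    ∃ V, IsDiagramBlock P V ∧ i ∈ V := by
  by_cases h : i.val ∈ openPoints n P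
  · exact ⟨{i}, Or.inr ⟨i, h, rfl⟩, Finset.mem_singleton_self i⟩
  · have h_end : ∃ v ∈ P, i.val = v.1 ∨ i.val = v.2 := by
      simp only [mem_openPoints, i.isLt, true_and] at h
      push Not at h
      obtain ⟨v, hv, h_end⟩ := h
      exact ⟨v, hv, or_iff_not_imp_left.2 h_end⟩
    obtain ⟨v, hv, h_end⟩ := h_end
    have h_snd := hP.snd_lt v hv
    refine ⟨{⟨v.1, (hP.fst_lt_snd v hv).trans h_snd⟩, ⟨v.2, h_snd⟩}, Or.inl ⟨_, _, hv, rfl⟩, ?_⟩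
    simpa [Fin.ext_iff] using h_end

theorem IsDiagramBlock.eq_of_mem (hP : IsDiagram ε n P) (hV : IsDiagramBlock P V)
    (hW : IsDiagramBlock P W) {i : Fin n} (hiV : i ∈ V) (hiW : i ∈ W) : V = W := by
  rcases hV with ⟨a, b, hab, rfl⟩ | ⟨a, ha, rfl⟩ <;>
    rcases hW with ⟨c, d, hcd, rfl⟩ | ⟨c, hc, rfl⟩ <;>
    simp only [Finset.mem_insert, Finset.mem_singleton, Fin.ext_iff] at hiV hiW
  · have h_eq := hP.eq_of_mem_endpoints hab hcd hiV hiW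
    rw [Prod.mk.injEq, Fin.val_inj, Fin.val_inj] at h_eq
    rw [h_eq.1, h_eq.2]
  · have h_open := (mem_openPoints.1 hc).2 _ hab
    omega
  · have h_open := (mem_openPoints.1 ha).2 _ hcd
    omega
  · rw [Fin.ext (hiV.symm.trans hiW)]

open Classical in
/-- The partition of `{0, …, n - 1}` with a given diagram. -/
def partitionOf (hP : IsDiagram ε n P) : SetPartition n :=
  Finpartition.ofExistsUnique (Finset.univ.filter (IsDiagramBlock P))
    (fun _ _ => Finset.subset_univ _)
    (fun i _ => by
      obtain ⟨V, hV, hiV⟩ := hP.exists_isDiagramBlock i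
      refine ⟨V, ⟨by simpa using hV, hiV⟩, fun W hW => ?_⟩
      exact IsDiagramBlock.eq_of_mem hP (by simpa using hW.1) hV hW.2 hiV)
    (by simp [IsDiagramBlock, eq_comm (a := (∅ : Finset (Fin n)))])

theorem mem_parts_partitionOf (hP : IsDiagram ε n P) :
    V ∈ (partitionOf hP).parts ↔ IsDiagramBlock P V := by
  simp [partitionOf, Finpartition.ofExistsUnique]

theorem isCompatible_partitionOf (hP : IsDiagram ε n P) :
    IsCompatible (fun i : Fin n => ε i) (partitionOf hP) := by
  intro V
  rcases (mem_parts_partitionOf hP).1 V.2 with ⟨i, j, hij, hV⟩ | ⟨i, h_open, hV⟩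
  · left
    obtain ⟨hp, h_lo, h_hi⟩ := isPair_and_lo_hi_of_eq_pair (hP.fst_lt_snd _ hij) hV
    rw [h_lo, h_hi]
    exact ⟨hp, hP.star_fst _ hij, hP.one_snd _ hij⟩
  · right
    have h_lo := lo_mem V
    rw [hV, Finset.mem_singleton] at h_lo
    rw [h_lo]
    exact ⟨by rw [IsSingleton, hV, Finset.card_singleton], hP.star_of_mem_openPoints h_open⟩

theorem diagram_partitionOf (hP : IsDiagram ε n P) : diagram (partitionOf hP) = P := by
  ext v
  rw [mem_diagram]
  constructor
  · rintro ⟨V, hp, rfl⟩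
    rcases (mem_parts_partitionOf hP).1 V.2 with ⟨i, j, hij, hV⟩ | ⟨i, -, hV⟩
    · obtain ⟨-, h_lo, h_hi⟩ := isPair_and_lo_hi_of_eq_pair (hP.fst_lt_snd _ hij) hV
      rwa [h_lo, h_hi]
    · exact absurd (by rw [IsSingleton, hV, Finset.card_singleton]) hp.not_isSingleton
  · intro hv
    have h_lt := hP.fst_lt_snd v hv
    have h_snd := hP.snd_lt v hv
    let V : Block (partitionOf hP) := ⟨{⟨v.1, h_lt.trans h_snd⟩, ⟨v.2, h_snd⟩},
      (mem_parts_partitionOf hP).2 (Or.inl ⟨_, _, hv, rfl⟩)⟩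
    obtain ⟨hp, h_lo, h_hi⟩ := isPair_and_lo_hi_of_eq_pair (V := V) h_lt rfl
    exact ⟨V, hp, by rw [h_lo, h_hi]⟩

theorem sum_partitions_diagram {M : Type*} [AddCommMonoid M] (ε : ℕ → Exponent) (n : ℕ)
    (F : Finset (ℕ × ℕ) → M) :
    ∑ π ∈ partitions (fun i : Fin n => ε i), F (diagram π) = ∑ P ∈ diagrams ε n, F P := by
  refine Finset.sum_bij (fun π _ => diagram π)
    (fun π hπ => mem_diagrams.2 (mem_partitions.1 hπ).isDiagram_diagram)
    (fun π hπ π' hπ' => diagram_injOn _ hπ hπ') (fun P hP => ?_) fun _ _ => rfl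
  rw [mem_diagrams] at hP
  exact ⟨partitionOf hP, mem_partitions.2 (isCompatible_partitionOf hP), diagram_partitionOf hP⟩

end PartitionOfDiagram

section Statistics

variable {n : ℕ} {π : SetPartition n} {ε : Fin n → Exponent}

namespace IsCompatible

theorem coverCount_eq_diagramCover (h : IsCompatible ε π) (V : Block π) :
    coverCount V = diagramCover (diagram π) (endpoints π V) := by
  classical
  rw [diagramCover, diagram, Finset.sum_map, ← Finset.card_filter, coverCount]
  congr 1
  ext W
  rw [Finset.mem_filter_univ, Finset.mem_filter, mem_pairs, h.covers_iff]
  rfl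

theorem singletonsLeft_eq_diagramLeft (h : IsCompatible ε π) (V : Block π) :
    singletonsLeft V = diagramLeft n (diagram π) (endpoints π V) := by
  classical
  rw [diagramLeft, h.openPoints_diagram, Finset.sum_map, ← Finset.card_filter, singletonsLeft]
  congr 1
  ext W
  rw [Finset.mem_filter_univ, Finset.mem_filter, mem_singletonBlocks, leftOf_iff]
  refine and_congr_right fun hW => ?_
  rw [hW.hi_eq]
  rfl

theorem innerSingletons_eq_diagramInner (h : IsCompatible ε π) :
    innerSingletons π = diagramInner n (diagram π) := by
  classical
  rw [diagramInner, h.openPoints_diagram, Finset.sum_map, diagram]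
  simp only [Finset.sum_map]
  rw [← Finset.sum_product', ← Finset.card_filter, innerSingletons]
  congr 1
  ext p
  rw [Finset.mem_filter_univ, Finset.mem_filter, Finset.mem_product, mem_singletonBlocks, mem_pairs,
    h.covers_iff, and_assoc]
  refine and_congr_right fun hV => ?_
  rw [hV.hi_eq]
  rfl

theorem crossings_eq_diagramCrossings (h : IsCompatible ε π) :
    crossings π = diagramCrossings (diagram π) := by
  classical
  rw [diagramCrossings, diagram, Finset.sum_map]
  simp only [Finset.sum_map]
  rw [← Finset.sum_product', ← Finset.card_filter, crossings]
  symm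
  refine Finset.card_bij (fun p _ => {p.1, p.2}) ?_ ?_ ?_
  · rintro ⟨V, W⟩ hVW
    rw [Finset.mem_filter, Finset.mem_product, mem_pairs, mem_pairs] at hVW
    obtain ⟨⟨hV, hW⟩, h_cross⟩ := hVW
    refine Finset.mem_filter_univ _ |>.2 ⟨V, W, ?_, rfl, h.cross_iff.2 ⟨hV, hW, h_cross⟩⟩
    rintro rfl
    exact lt_irrefl _ h_cross.1
  · rintro ⟨V, W⟩ hVW ⟨V', W'⟩ hVW' h_eq
    have h_lt : lo V < lo W := (Finset.mem_filter.1 hVW).2.1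
    have h_lt' : lo V' < lo W' := (Finset.mem_filter.1 hVW').2.1
    replace h_eq : ({V, W} : Set (Block π)) = {V', W'} := by
      simpa only [Finset.coe_pair] using
        congrArg (fun S : Finset (Block π) => (S : Set (Block π))) h_eq
    rcases Set.pair_eq_pair_iff.1 h_eq with ⟨rfl, rfl⟩ | ⟨rfl, rfl⟩
    · rfl
    · exact absurd h_lt h_lt'.not_gt
  · intro S hS
    obtain ⟨V, W, -, rfl, h_cross⟩ := Finset.mem_filter_univ _ |>.1 hS
    obtain ⟨hV, hW, h_lt⟩ := h.cross_iff.1 h_cross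
    exact ⟨(V, W), Finset.mem_filter.2
      ⟨Finset.mem_product.2 ⟨mem_pairs.2 hV, mem_pairs.2 hW⟩, h_lt⟩, rfl⟩

end IsCompatible

theorem innerNegativeBlocks_eq_sum_coverCount (p : SetPartitionB n) :
    innerNegativeBlocks p = ∑ V ∈ pairs p.1 with p.2 V = -1, coverCount V := by
  classical
  simp only [coverCount, Finset.card_filter]
  rw [innerNegativeBlocks, Finset.card_filter, Fintype.sum_prod_type, Finset.sum_filter, pairs,
    Finset.sum_filter]
  refine Finset.sum_congr rfl fun V _ => ?_
  by_cases hV : IsPair V <;> by_cases h_neg : p.2 V = -1 <;> simp [hV, h_neg]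

theorem singletonsLeftNegative_eq_sum_singletonsLeft (p : SetPartitionB n) :
    singletonsLeftNegative p = ∑ V ∈ pairs p.1 with p.2 V = -1, singletonsLeft V := by
  classical
  simp only [singletonsLeft, Finset.card_filter]
  rw [singletonsLeftNegative, Finset.card_filter, Fintype.sum_prod_type_right, Finset.sum_filter,
    pairs, Finset.sum_filter]
  refine Finset.sum_congr rfl fun V _ => ?_
  by_cases hV : IsPair V <;> by_cases h_neg : p.2 V = -1 <;> simp [hV, h_neg]

end Statistics

/-! ### Colourings of the pairs -/

section Colourings

variable {n : ℕ} {π : SetPartition n}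

open Classical in
/-- The colourings of the blocks of `π` by `±1` that are `1` on the singletons. -/
def colourings (π : SetPartition n) : Finset (Block π → ℤˣ) := {f | ∀ V, IsSingleton V → f V = 1}

theorem mem_colourings {f : Block π → ℤˣ} :
    f ∈ colourings π ↔ ∀ V, IsSingleton V → f V = 1 := by
  simp [colourings]

theorem negativeBlocks_eq_card (h : ∀ V : Block π, IsPair V ∨ IsSingleton V) {f : Block π → ℤˣ}
    (hf : f ∈ colourings π) :
    negativeBlocks ⟨π, f⟩ = Finset.card {V ∈ pairs π | f V = -1} := by
  rw [negativeBlocks]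
  congr 1
  ext V
  rw [Finset.mem_filter_univ, Finset.mem_filter, mem_pairs, iff_and_self]
  refine fun h_neg => (h V).resolve_right fun hV => ?_
  exact absurd ((mem_colourings.1 hf V hV).symm.trans h_neg) (by decide)

theorem prod_pairs_add {R : Type*} [CommSemiring R]
    (h : ∀ V : Block π, IsPair V ∨ IsSingleton V) (a b : Block π → R) :
    ∏ V ∈ pairs π, (a V + b V) = ∑ f ∈ colourings π,
      (∏ V ∈ pairs π with f V = 1, a V) * ∏ V ∈ pairs π with f V = -1, b V := by
  classical
  have h_ne : (1 : ℤˣ) ≠ -1 := by decide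
  let colours (V : Block π) : Finset ℤˣ := if IsSingleton V then {1} else Finset.univ
  let factor (V : Block π) (s : ℤˣ) : R := if IsPair V then (if s = 1 then a V else b V) else 1
  have h_colourings : colourings π = Fintype.piFinset colours := by
    ext f
    rw [mem_colourings, Fintype.mem_piFinset]
    refine forall_congr' fun V => ?_
    by_cases hV : IsSingleton V <;> simp [colours, hV, Int.units_eq_one_or]
  have h_sum : ∀ V, ∑ s ∈ colours V, factor V s = if IsPair V then a V + b V else 1 := by
    intro V
    rcases h V with hV | hV
    · simp [colours, factor, hV, hV.not_isSingleton, h_ne.symm]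
    · have h_pair : ¬IsPair V := fun hp => hp.not_isSingleton hV
      simp [colours, factor, hV, h_pair]
  have h_prod : ∀ f : Block π → ℤˣ, ∏ V, factor V (f V) =
      (∏ V ∈ pairs π with f V = 1, a V) * ∏ V ∈ pairs π with f V = -1, b V := by
    intro f
    rw [Finset.prod_filter, Finset.prod_filter, ← Finset.prod_mul_distrib, pairs,
      Finset.prod_filter]
    refine Finset.prod_congr rfl fun V _ => ?_
    rcases Int.units_eq_one_or (f V) with hf | hf <;> simp [factor, hf, h_ne, h_ne.symm]
  rw [pairs, Finset.prod_filter, ← Finset.prod_congr rfl fun V _ => h_sum V,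
    Finset.prod_univ_sum, ← h_colourings]
  exact Finset.sum_congr rfl fun f _ => h_prod f

theorem sum_partitionsB {M : Type*} [AddCommMonoid M] (ε : Fin n → Exponent)
    (F : SetPartitionB n → M) :
    ∑ p ∈ partitionsB ε, F p = ∑ π ∈ partitions ε, ∑ f ∈ colourings π, F ⟨π, f⟩ := by
  rw [Finset.sum_sigma']
  refine Finset.sum_congr ?_ fun _ _ => rfl
  ext p
  simp [partitionsB, mem_partitions, mem_colourings]

end Colourings

/-! ### The Wick formula -/

section WickFormula

variable {H : Type*} [NormedAddCommGroup H] [InnerProductSpace ℂ H] {n : ℕ}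

/-- The coefficient of the partition `π` in the Wick formula. -/
def partitionWeight (J : H →ₗ[ℂ] H) (α q : ℝ) (x : Fin n → H) (π : SetPartition n) : ℂ :=
  (q : ℂ) ^ (crossings π + innerSingletons π) *
    ∏ V ∈ pairs π, (⟪x (hi V), x (lo V)⟫_ℂ +
      (α : ℂ) * (q : ℂ) ^ (2 * coverCount V + 2 * singletonsLeft V) * ⟪x (hi V), J (x (lo V))⟫_ℂ)

/-- The coefficient of the coloured partition `p` in the Wick formula. -/
def colouredWeight (J : H →ₗ[ℂ] H) (α q : ℝ) (x : Fin n → H) (p : SetPartitionB n) : ℂ :=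
  (α : ℂ) ^ negativeBlocks p *
    (q : ℂ) ^ (crossings p.1 + innerSingletons p.1 + 2 * innerNegativeBlocks p +
      2 * singletonsLeftNegative p) *
    (∏ V ∈ pairs p.1 with p.2 V = 1, ⟪x (hi V), x (lo V)⟫_ℂ) *
    (∏ V ∈ pairs p.1 with p.2 V = -1, ⟪x (hi V), J (x (lo V))⟫_ℂ)

theorem IsCompatible.diagramWeight_diagram (J : H →ₗ[ℂ] H) (α q : ℝ) (x : ℕ → H)
    {ε : Fin n → Exponent} {π : SetPartition n} (h : IsCompatible ε π) :
    diagramWeight J α q x n (diagram π) = partitionWeight J α q (fun i : Fin n => x i) π := by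
  rw [diagramWeight, ← h.crossings_eq_diagramCrossings, ← h.innerSingletons_eq_diagramInner,
    partitionWeight]
  congr 1
  conv_lhs => rw [diagram, Finset.prod_map]
  refine Finset.prod_congr rfl fun V _ => ?_
  rw [h.coverCount_eq_diagramCover, h.singletonsLeft_eq_diagramLeft]
  rfl

theorem sum_colouredWeight (J : H →ₗ[ℂ] H) (α q : ℝ) (x : Fin n → H) {π : SetPartition n}
    (h : ∀ V : Block π, IsPair V ∨ IsSingleton V) :
    ∑ f ∈ colourings π, colouredWeight J α q x ⟨π, f⟩ = partitionWeight J α q x π := by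
  rw [partitionWeight, prod_pairs_add h, Finset.mul_sum]
  refine Finset.sum_congr rfl fun f hf => ?_
  rw [colouredWeight, negativeBlocks_eq_card h hf, innerNegativeBlocks_eq_sum_coverCount,
    singletonsLeftNegative_eq_sum_singletonsLeft]
  simp only [Finset.prod_mul_distrib, Finset.prod_const, Finset.prod_pow_eq_pow_sum,
    ← Finset.mul_sum, pow_add]
  ring

theorem fockWord_vacuum_eq_sum_partitions {J : H →ₗ[ℂ] H} (hJ : Function.Involutive J) {α q : ℝ}
    (hα : α ∈ Set.Ioo (-1 : ℝ) 1) (hq : q ∈ Set.Ioo (-1 : ℝ) 1) (x : Fin n → H)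
    (ε : Fin n → Exponent) : fockWord J α q ε x vacuum =
      ∑ π ∈ partitions ε, partitionWeight J α q x π • tensorOver x (singletons π) := by
  obtain ⟨ε, rfl⟩ : ∃ ε' : ℕ → Exponent, (fun i : Fin n => ε' i) = ε :=
    ⟨fun i => if h : i < n then ε ⟨i, h⟩ else .star, by ext1 i; simp⟩
  obtain ⟨x, rfl⟩ : ∃ x' : ℕ → H, (fun i : Fin n => x' i) = x :=
    ⟨fun i => if h : i < n then x ⟨i, h⟩ else 0, by ext1 i; simp⟩
  rw [fockWord_vacuum_eq_sum_diagrams hJ hα hq, ← sum_partitions_diagram]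
  refine Finset.sum_congr rfl fun π hπ => ?_
  have h := mem_partitions.1 hπ
  rw [h.diagramWeight_diagram, h.openPoints_diagram, ← map_val_singletons]
  exact congrArg _ (orderedTensor_map x (Fin.valOrderEmb n) (singletons π))

theorem fockWord_vacuum_eq_sum_partitionsB {J : H →ₗ[ℂ] H} (hJ : Function.Involutive J)
    {α q : ℝ} (hα : α ∈ Set.Ioo (-1 : ℝ) 1) (hq : q ∈ Set.Ioo (-1 : ℝ) 1) (x : Fin n → H)
    (ε : Fin n → Exponent) : fockWord J α q ε x vacuum =
      ∑ p ∈ partitionsB ε, colouredWeight J α q x p • tensorOver x (singletons p.1) := by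
  rw [fockWord_vacuum_eq_sum_partitions hJ hα hq, sum_partitionsB]
  refine Finset.sum_congr rfl fun π hπ => ?_
  rw [← sum_colouredWeight J α q x (mem_partitions.1 hπ).isPair_or_isSingleton, Finset.sum_smul]

theorem mainTheorem6_general {J : H →ₗ[ℂ] H} (hJ : Function.Involutive J) {α q : ℝ}
    (hα : α ∈ Set.Ioo (-1 : ℝ) 1) (hq : q ∈ Set.Ioo (-1 : ℝ) 1) (x : Fin n → H)
    (ε : Fin n → Exponent) :
    (∀ (y : H) (T : Module.End ℂ (Fock H)),
      IsCreationAdjoint J α q y T ↔ T = annihilation J α q y) ∧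
    fockWord J α q ε x vacuum =
      ∑ p ∈ partitionsB ε,
        ((α : ℂ) ^ negativeBlocks p *
          (q : ℂ) ^ (crossings p.1 + innerSingletons p.1 + 2 * innerNegativeBlocks p +
            2 * singletonsLeftNegative p) *
          (∏ V ∈ pairs p.1 with p.2 V = 1, ⟪x (hi V), x (lo V)⟫_ℂ) *
          (∏ V ∈ pairs p.1 with p.2 V = -1, ⟪x (hi V), J (x (lo V))⟫_ℂ)) •
        tensorOver x (singletons p.1) ∧
    fockWord J α q ε x vacuum =
      ∑ π ∈ partitions ε,
        ((q : ℂ) ^ (crossings π + innerSingletons π) *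
          ∏ V ∈ pairs π, (⟪x (hi V), x (lo V)⟫_ℂ +
            (α : ℂ) * (q : ℂ) ^ (2 * coverCount V + 2 * singletonsLeft V) *
              ⟪x (hi V), J (x (lo V))⟫_ℂ)) •
        tensorOver x (singletons π) :=
  ⟨isCreationAdjoint_iff hJ hα hq, fockWord_vacuum_eq_sum_partitionsB hJ hα hq x ε,
    fockWord_vacuum_eq_sum_partitions hJ hα hq x ε⟩

end WickFormula

theorem inner_ofReal_comm {V : Type*} [NormedAddCommGroup V] [InnerProductSpace ℝ V]
    {z w : Complexification V} (hz : z ∈ Set.range (Complexification.ofReal (V := V)))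
    (hw : w ∈ Set.range (Complexification.ofReal (V := V))) : ⟪z, w⟫_ℂ = ⟪w, z⟫_ℂ := by
  obtain ⟨a, rfl⟩ := hz
  obtain ⟨b, rfl⟩ := hw
  simp [Complexification.inner_def, Complexification.ofReal, real_inner_comm]

end TypeBFock

end

open TypeBFock in
theorem mainTheorem6 {HR : Type*} [NormedAddCommGroup HR] [InnerProductSpace ℝ HR]
    [CompleteSpace HR] [TopologicalSpace.SeparableSpace HR]
    (J : Complexification HR →ₗ[ℂ] Complexification HR)
    (hJ : Function.Involutive J) (hJsa : J.IsSymmetric)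
    (α q : ℝ) (hα : α ∈ Set.Ioo (-1 : ℝ) 1) (hq : q ∈ Set.Ioo (-1 : ℝ) 1)
    (n : ℕ) (x : Fin n → Complexification HR)
    (hx : ∀ i, x i ∈ Set.range (Complexification.ofReal (V := HR)))
    (ε : Fin n → Exponent) :
    -- the annihilation operator is the unique adjoint of the creation operator
    (∀ (y : Complexification HR) (T : Module.End ℂ (Fock (Complexification HR))),
      IsCreationAdjoint J α q y T ↔ T = annihilation J α q y) ∧
    -- the formula over coloured partitions
    fockWord J α q ε x vacuum =
      ∑ p ∈ partitionsB ε,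
        ((α : ℂ) ^ negativeBlocks p *
          (q : ℂ) ^ (crossings p.1 + innerSingletons p.1 + 2 * innerNegativeBlocks p +
            2 * singletonsLeftNegative p) *
          (∏ V ∈ pairs p.1 with p.2 V = 1, ⟪x (hi V), x (lo V)⟫_ℂ) *
          (∏ V ∈ pairs p.1 with p.2 V = -1, ⟪x (hi V), J (x (lo V))⟫_ℂ)) •
        tensorOver x (singletons p.1) ∧
    -- the formula over uncoloured partitions
    fockWord J α q ε x vacuum =
      ∑ π ∈ partitions ε,
        ((q : ℂ) ^ (crossings π + innerSingletons π) *
          ∏ V ∈ pairs π, (⟪x (hi V), x (lo V)⟫_ℂ +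
            (α : ℂ) * (q : ℂ) ^ (2 * coverCount V + 2 * singletonsLeft V) *
              ⟪x (hi V), J (x (lo V))⟫_ℂ)) •
        tensorOver x (singletons π) ∧
    -- the order of the two elements of a pair is immaterial when `J` preserves the real space
    (∀ i j, ⟪x i, x j⟫_ℂ = ⟪x j, x i⟫_ℂ) ∧
    (Set.MapsTo J (Set.range (Complexification.ofReal (V := HR)))
        (Set.range (Complexification.ofReal (V := HR))) →
      ∀ i j, ⟪x i, J (x j)⟫_ℂ = ⟪x j, J (x i)⟫_ℂ) :=
  have ⟨h_adjoint, h_coloured, h_uncoloured⟩ := mainTheorem6_general hJ hα hq x ε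
  ⟨h_adjoint, h_coloured, h_uncoloured, fun i j => inner_ofReal_comm (hx i) (hx j),
    fun h_maps i j =>
      (inner_ofReal_comm (hx i) (h_maps (hx j))).trans (hJsa (x j) (x i))⟩
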